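/- **Theorem 3.10.** All Hilbert modules are right Hilbert $C^*$-modules, that is, complete in the norm $\|x\|=\|\langle x,x\rangle\|^{1/2}$, and a bounded module map $T:E\to F$ between Hilbert $A$-modules is a bounded linear map with $T(xa)=T(x)a$ for all $x\in E$, $a\in A$ (no adjoint is required). Let $\mathcal K$ be the $C^*$-algebra of compact operators on $\ell^2$. For a $C^*$-algebra $B$, let $LM(B)$ be the algebra of left multipliers of $B$, i.e. of bounded linear maps $T:B\to B$ with $T(xy)=T(x)y$, and let $M(B)\subseteq LM(B)$ be the multiplier algebra, where a double centralizer $(L,R)$ (bounded linear maps $L,R:B\to B$ with $R(x)y=xL(y)$) is identified with $L$. Let $A$ be a separable $C^*$-algebra (not necessarily unital) such that $LM(A\otimes\mathcal K)=M(A\otimes\mathcal K)$. Let $H$ be a countably generated Hilbert $A$-module, i.e. there is a countable set $S\subseteq H$ such that the linear span of $\{xa : x\in S,\ a\in A\}$ is dense in $H$. Then $H$ is projective in the category of Hilbert $A$-modules with bounded module maps as morphisms: for all Hilbert $A$-modules $H_1,H_2$, every surjective bounded module map $\varphi:H_1\to H_2$ and every bounded module map $\psi:H\to H_2$, there is a bounded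 module map $\chi:H\to H_1$ with $\varphi\circ\chi=\psi$. -/

import Mathlib

open scoped TensorProduct

universe u v w₁ w₂

noncomputable section

/-! ### The C⋆-algebra of compact operators on `ℓ²` -/

/-- The Hilbert space `ℓ²(ℕ)`. -/
abbrev EllTwo : Type := lp (fun _ : ℕ => ℂ) 2

/-- Schauder's theorem on a Hilbert space: the adjoint of a compact operator is compact. -/
theorem isCompactOperator_star {E : Type*} [NormedAddCommGroup E] [InnerProductSpace ℂ E]
    [CompleteSpace E] {T : E →L[ℂ] E} (hT : IsCompactOperator T) :
    IsCompactOperator (star T : E →L[ℂ] E) := by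
  have hS : IsCompactOperator (T ∘L star T : E →L[ℂ] E) := hT.comp_clm (star T)
  have h1 := isCompactOperator_iff_isCompact_closure_image_closedBall
    ((star T : E →L[ℂ] E) : E →ₗ[ℂ] E) (zero_lt_one' ℝ)
  refine h1.2 ?_
  have h2 : IsCompact (closure ((T ∘L star T : E →L[ℂ] E) '' Metric.closedBall 0 1)) :=
    (isCompactOperator_iff_isCompact_closure_image_closedBall
      ((T ∘L star T : E →L[ℂ] E) : E →ₗ[ℂ] E) (zero_lt_one' ℝ)).1 hS
  have h3 := h2.totallyBounded.subset subset_closure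
  refine (TotallyBounded.closure ?_).isCompact_of_isClosed isClosed_closure
  rw [Metric.totallyBounded_iff]
  intro ε hε
  obtain ⟨t, htS, htf, ht⟩ :=
    Metric.finite_approx_of_totallyBounded h3 (ε ^ 2 / 2) (by positivity)
  have htS' : ∀ y ∈ t, ∃ x, x ∈ Metric.closedBall (0 : E) 1 ∧ (T ∘L star T : E →L[ℂ] E) x = y :=
    fun y hy => htS hy
  choose! g hg using htS'
  refine ⟨(star T : E →L[ℂ] E) '' (g '' t), (htf.image _).image _, ?_⟩
  rintro _ ⟨x, hx, rfl⟩
  have hxt := ht ⟨x, hx, rfl⟩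
  simp only [Set.mem_iUnion] at hxt
  obtain ⟨y, hy, hxy⟩ := hxt
  obtain ⟨hgy, hgy'⟩ := hg y hy
  simp only [Set.mem_iUnion]
  refine ⟨_, ⟨_, ⟨y, hy, rfl⟩, rfl⟩, ?_⟩
  rw [← hgy', Metric.mem_ball, dist_eq_norm] at hxy
  rw [Metric.mem_ball, dist_eq_norm]
  set z := x - g y with hz
  have hz2 : ‖z‖ ≤ 2 := by
    have := norm_sub_le x (g y)
    have a1 := mem_closedBall_zero_iff.1 hx
    have a2 := mem_closedBall_zero_iff.1 hgy
    linarith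
  have e1 : ‖(star T : E →L[ℂ] E) z‖ ^ 2 ≤ ‖(T ∘L star T : E →L[ℂ] E) z‖ * ‖z‖ := by
    have : inner ℂ ((star T : E →L[ℂ] E) z) ((star T : E →L[ℂ] E) z)
        = inner ℂ ((T ∘L star T : E →L[ℂ] E) z) z := by
      rw [ContinuousLinearMap.star_eq_adjoint, ContinuousLinearMap.adjoint_inner_right]; rfl
    have h4 := inner_self_eq_norm_sq_to_K (𝕜 := ℂ) ((star T : E →L[ℂ] E) z)
    have h5 := norm_inner_le_norm (𝕜 := ℂ) ((T ∘L star T : E →L[ℂ] E) z) z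
    rw [← this, h4] at h5
    simpa using h5
  have e2 : ‖(T ∘L star T : E →L[ℂ] E) z‖ < ε ^ 2 / 2 := by
    rw [hz, map_sub]; exact hxy
  have e3 : ‖(star T : E →L[ℂ] E) z‖ ^ 2 < ε ^ 2 := by
    nlinarith [norm_nonneg ((T ∘L star T : E →L[ℂ] E) z), norm_nonneg z]
  have := lt_of_pow_lt_pow_left₀ 2 hε.le e3
  rwa [hz, map_sub] at this

/-- The compact operators on `ℓ²(ℕ)`, as a ⋆-subalgebra of the bounded operators. -/
def compactsEllTwo : NonUnitalStarSubalgebra ℂ (EllTwo →L[ℂ] EllTwo) where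
  carrier := {T | IsCompactOperator T}
  add_mem' hS hT := IsCompactOperator.add hS hT
  zero_mem' := isCompactOperator_zero
  mul_mem' {_ T} hS _ := IsCompactOperator.comp_clm hS T
  smul_mem' c _ hT := IsCompactOperator.smul hT c
  star_mem' hT := isCompactOperator_star hT

theorem isClosed_compactsEllTwo : IsClosed (compactsEllTwo : Set (EllTwo →L[ℂ] EllTwo)) :=
  isClosed_setOfPred_isCompactOperator

/-- The C⋆-algebra `𝒦` of compact operators on `ℓ²(ℕ)`. -/
def CompactsEllTwo : Type := compactsEllTwo

instance : NonUnitalCStarAlgebra CompactsEllTwo :=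
  NonUnitalStarSubalgebra.nonUnitalCStarAlgebra compactsEllTwo
    (h_closed := isClosed_compactsEllTwo)

/-! ### The C⋆-tensor product -/

namespace CStarTensor

section

variable (A B : Type*) [NonUnitalCStarAlgebra A] [NonUnitalCStarAlgebra B]

/-- A C⋆-seminorm on the algebraic tensor product `A ⊙ B`. The bound `‖a ⊗ b‖ ≤ ‖a‖ ‖b‖`, which
every C⋆-seminorm on `A ⊙ B` satisfies, is recorded as part of the definition. -/
structure IsCStarSeminorm {A B : Type*} [NonUnitalCStarAlgebra A] [NonUnitalCStarAlgebra B]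
    (p : Seminorm ℂ (A ⊗[ℂ] B)) : Prop where
  mul_le : ∀ s t, p (s * t) ≤ p s * p t
  star_mul_self : ∀ t, p (star t * t) = p t ^ 2
  tmul_le : ∀ (a : A) (b : B), p (a ⊗ₜ[ℂ] b) ≤ ‖a‖ * ‖b‖

variable {A B} in
/-- The largest C⋆-seminorm on `A ⊙ B`. -/
def maxNorm (t : A ⊗[ℂ] B) : ℝ :=
  ⨆ p : {p : Seminorm ℂ (A ⊗[ℂ] B) // IsCStarSeminorm p}, p.1 t

instance : Nonempty {p : Seminorm ℂ (A ⊗[ℂ] B) // IsCStarSeminorm p} :=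
  ⟨⟨0, ⟨by simp, by simp, fun a b => by simpa using by positivity⟩⟩⟩

variable {A B}

theorem bddAbove_seminorms (t : A ⊗[ℂ] B) :
    BddAbove (Set.range fun p : {p : Seminorm ℂ (A ⊗[ℂ] B) // IsCStarSeminorm p} => p.1 t) := by
  induction t with
  | zero => exact ⟨0, by rintro _ ⟨p, rfl⟩; simp⟩
  | tmul a b => exact ⟨‖a‖ * ‖b‖, by rintro _ ⟨p, rfl⟩; exact p.2.tmul_le a b⟩
  | add x y hx hy =>
    obtain ⟨c, hc⟩ := hx
    obtain ⟨d, hd⟩ := hy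
    refine ⟨c + d, ?_⟩
    rintro _ ⟨p, rfl⟩
    exact (map_add_le_add p.1 x y).trans (add_le_add (hc ⟨p, rfl⟩) (hd ⟨p, rfl⟩))

theorem le_maxNorm {p : Seminorm ℂ (A ⊗[ℂ] B)} (hp : IsCStarSeminorm p) (t : A ⊗[ℂ] B) :
    p t ≤ maxNorm t :=
  le_ciSup (bddAbove_seminorms t) ⟨p, hp⟩

theorem maxNorm_nonneg (t : A ⊗[ℂ] B) : 0 ≤ maxNorm t :=
  Real.iSup_nonneg fun p => apply_nonneg p.1 t

theorem maxNorm_zero : maxNorm (0 : A ⊗[ℂ] B) = 0 := by simp [maxNorm]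

theorem maxNorm_add_le (s t : A ⊗[ℂ] B) : maxNorm (s + t) ≤ maxNorm s + maxNorm t :=
  ciSup_le fun p => (map_add_le_add p.1 s t).trans
    (add_le_add (le_maxNorm p.2 s) (le_maxNorm p.2 t))

theorem maxNorm_neg (t : A ⊗[ℂ] B) : maxNorm (-t) = maxNorm t := by
  simp [maxNorm, map_neg_eq_map]

theorem maxNorm_smul_le (c : ℂ) (t : A ⊗[ℂ] B) : maxNorm (c • t) ≤ ‖c‖ * maxNorm t :=
  ciSup_le fun p => by
    rw [map_smul_eq_mul]
    exact mul_le_mul_of_nonneg_left (le_maxNorm p.2 t) (norm_nonneg c)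

theorem maxNorm_mul_le (s t : A ⊗[ℂ] B) : maxNorm (s * t) ≤ maxNorm s * maxNorm t :=
  ciSup_le fun p => (p.2.mul_le s t).trans
    (mul_le_mul (le_maxNorm p.2 s) (le_maxNorm p.2 t) (apply_nonneg p.1 t) (maxNorm_nonneg s))

theorem sq_maxNorm_le (t : A ⊗[ℂ] B) : maxNorm t ^ 2 ≤ maxNorm (star t * t) := by
  have h : maxNorm t ≤ √(maxNorm (star t * t)) := ciSup_le fun p => by
    refine Real.le_sqrt_of_sq_le ?_
    rw [← p.2.star_mul_self t]
    exact le_maxNorm p.2 _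
  calc maxNorm t ^ 2 ≤ √(maxNorm (star t * t)) ^ 2 :=
        pow_le_pow_left₀ (maxNorm_nonneg t) h 2
    _ = maxNorm (star t * t) := Real.sq_sqrt (maxNorm_nonneg _)

theorem maxNorm_star_le (t : A ⊗[ℂ] B) : maxNorm (star t) ≤ maxNorm t := by
  have h1 := sq_maxNorm_le (star t)
  rw [star_star] at h1
  have h2 := maxNorm_mul_le t (star t)
  have h3 := maxNorm_nonneg (star t)
  have h4 := maxNorm_nonneg t
  by_contra! h
  nlinarith

variable (A B)

/-- The algebraic tensor product `A ⊙ B`, to be equipped with the largest C⋆-seminorm. -/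
def Alg : Type _ := A ⊗[ℂ] B

instance : NonUnitalRing (Alg A B) := inferInstanceAs (NonUnitalRing (A ⊗[ℂ] B))
instance : StarRing (Alg A B) := inferInstanceAs (StarRing (A ⊗[ℂ] B))
instance : Module ℂ (Alg A B) := inferInstanceAs (Module ℂ (A ⊗[ℂ] B))
instance : StarModule ℂ (Alg A B) := inferInstanceAs (StarModule ℂ (A ⊗[ℂ] B))
instance : IsScalarTower ℂ (Alg A B) (Alg A B) :=
  inferInstanceAs (IsScalarTower ℂ (A ⊗[ℂ] B) (A ⊗[ℂ] B))
instance : SMulCommClass ℂ (Alg A B) (Alg A B) :=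
  inferInstanceAs (SMulCommClass ℂ (A ⊗[ℂ] B) (A ⊗[ℂ] B))

instance : SeminormedAddCommGroup (Alg A B) :=
  AddGroupSeminorm.toSeminormedAddCommGroup
    { toFun := fun t : Alg A B => maxNorm (A := A) (B := B) t
      map_zero' := maxNorm_zero
      add_le' := maxNorm_add_le
      neg' := maxNorm_neg }

instance : NonUnitalSeminormedRing (Alg A B) where
  __ := (inferInstance : NonUnitalRing (Alg A B))
  __ := (inferInstance : SeminormedAddCommGroup (Alg A B))
  norm_mul_le := maxNorm_mul_le

instance : NormedSpace ℂ (Alg A B) where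
  norm_smul_le := maxNorm_smul_le

instance : NormedStarGroup (Alg A B) where
  norm_star_le := maxNorm_star_le

end

end CStarTensor

/-- The C⋆-tensor product `A ⊗ B`: the Hausdorff completion of the algebraic tensor product in
its largest C⋆-seminorm. When `A` or `B` is nuclear (for instance `B = 𝒦`), it is the only
C⋆-completion of `A ⊙ B`. -/
def CStarTensor (A B : Type*) [NonUnitalCStarAlgebra A] [NonUnitalCStarAlgebra B] : Type _ :=
  UniformSpace.Completion (CStarTensor.Alg A B)

namespace CStarTensor

section

open UniformSpace

variable (A B : Type*) [NonUnitalCStarAlgebra A] [NonUnitalCStarAlgebra B]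

instance : NormedAddCommGroup (CStarTensor A B) :=
  inferInstanceAs (NormedAddCommGroup (Completion (Alg A B)))
instance : NormedSpace ℂ (CStarTensor A B) :=
  inferInstanceAs (NormedSpace ℂ (Completion (Alg A B)))
instance : CompleteSpace (CStarTensor A B) :=
  inferInstanceAs (CompleteSpace (Completion (Alg A B)))

variable {A B}

/-- The canonical linear map `A ⊙ B → A ⊗ B`. -/
def ofAlg : Alg A B →L[ℂ] CStarTensor A B := Completion.toComplL

theorem norm_ofAlg (t : Alg A B) : ‖ofAlg t‖ = ‖t‖ := Completion.norm_coe t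

theorem denseRange_ofAlg : DenseRange (ofAlg : Alg A B → CStarTensor A B) :=
  Completion.denseRange_coe

theorem isDenseInducing_ofAlg : IsDenseInducing (ofAlg : Alg A B → CStarTensor A B) :=
  Completion.isDenseInducing_coe

/-- The product on `A ⊗ B`, extending that of `A ⊙ B` by continuity. -/
instance : Mul (CStarTensor A B) :=
  ⟨fun x y => (isDenseInducing_ofAlg.prodMap isDenseInducing_ofAlg).extend
    (fun p : Alg A B × Alg A B => ofAlg (p.1 * p.2)) (x, y)⟩

theorem ofAlg_mul (s t : Alg A B) : ofAlg (s * t) = ofAlg s * ofAlg t :=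
  ((isDenseInducing_ofAlg.prodMap isDenseInducing_ofAlg).extend_eq
    (f := fun p : Alg A B × Alg A B => ofAlg (p.1 * p.2))
    (ofAlg.continuous.comp continuous_mul) (s, t)).symm

instance : ContinuousMul (CStarTensor A B) where
  continuous_mul := by
    let m : Alg A B →+ Alg A B →+ CStarTensor A B :=
      (AddMonoidHom.mul : Alg A B →+ Alg A B →+ Alg A B).compr₂
        (ofAlg : Alg A B →L[ℂ] CStarTensor A B).toLinearMap.toAddMonoidHom
    have hm : Continuous fun p : Alg A B × Alg A B => m p.1 p.2 :=
      ofAlg.continuous.comp continuous_mul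
    have di : IsDenseInducing
        ((ofAlg : Alg A B →L[ℂ] CStarTensor A B).toLinearMap.toAddMonoidHom) :=
      isDenseInducing_ofAlg
    exact (di.extend_Z_bilin di hm :)

/-- The involution on `A ⊗ B`, extending that of `A ⊙ B` by continuity. -/
instance : Star (CStarTensor A B) :=
  ⟨isDenseInducing_ofAlg.extend fun t : Alg A B => ofAlg (star t)⟩

theorem ofAlg_star (t : Alg A B) : ofAlg (star t) = star (ofAlg t) :=
  (isDenseInducing_ofAlg.extend_eq (f := fun t : Alg A B => ofAlg (star t))
    (ofAlg.continuous.comp continuous_star) t).symm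

theorem continuous_star' : Continuous (star : CStarTensor A B → CStarTensor A B) := by
  let m : Alg A B →+ CStarTensor A B :=
    (ofAlg : Alg A B →L[ℂ] CStarTensor A B).toLinearMap.toAddMonoidHom.comp
      (starAddEquiv : Alg A B ≃+ Alg A B).toAddMonoidHom
  have hm : UniformContinuous m := uniformContinuous_addMonoidHom_of_continuous
    (f := m) (ofAlg.continuous.comp continuous_star)
  have hi : IsUniformInducing (ofAlg : Alg A B → CStarTensor A B) :=
    Completion.isUniformInducing_coe _
  exact (uniformContinuous_uniformly_extend hi denseRange_ofAlg hm).continuous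

theorem induction_on {p : CStarTensor A B → Prop} (x : CStarTensor A B)
    (hp : IsClosed {x | p x}) (h : ∀ t, p (ofAlg t)) : p x :=
  denseRange_ofAlg.induction_on x hp h

theorem induction_on₂ {p : CStarTensor A B → CStarTensor A B → Prop} (x y : CStarTensor A B)
    (hp : IsClosed {q : CStarTensor A B × CStarTensor A B | p q.1 q.2})
    (h : ∀ s t, p (ofAlg s) (ofAlg t)) : p x y :=
  denseRange_ofAlg.induction_on₂ hp h x y

theorem induction_on₃ {p : CStarTensor A B → CStarTensor A B → CStarTensor A B → Prop}
    (x y z : CStarTensor A B)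
    (hp : IsClosed {q : CStarTensor A B × CStarTensor A B × CStarTensor A B | p q.1 q.2.1 q.2.2})
    (h : ∀ s t u, p (ofAlg s) (ofAlg t) (ofAlg u)) : p x y z :=
  denseRange_ofAlg.induction_on₃ hp h x y z

instance : NonUnitalRing (CStarTensor A B) where
  zero_mul x := by
    induction x using induction_on with
    | hp => exact isClosed_eq (by fun_prop) continuous_const
    | h t => rw [← map_zero (ofAlg (A := A) (B := B)), ← ofAlg_mul, zero_mul]
  mul_zero x := by
    induction x using induction_on with
    | hp => exact isClosed_eq (by fun_prop) continuous_const
    | h t => rw [← map_zero (ofAlg (A := A) (B := B)), ← ofAlg_mul, mul_zero]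
  mul_assoc x y z := by
    induction x, y, z using induction_on₃ with
    | hp => exact isClosed_eq (by fun_prop) (by fun_prop)
    | h s t u => rw [← ofAlg_mul, ← ofAlg_mul, ← ofAlg_mul, ← ofAlg_mul, mul_assoc]
  left_distrib x y z := by
    induction x, y, z using induction_on₃ with
    | hp => exact isClosed_eq (by fun_prop) (by fun_prop)
    | h s t u => rw [← map_add, ← ofAlg_mul, ← ofAlg_mul, ← ofAlg_mul, ← map_add, mul_add]
  right_distrib x y z := by
    induction x, y, z using induction_on₃ with
    | hp => exact isClosed_eq (by fun_prop) (by fun_prop)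
    | h s t u => rw [← map_add, ← ofAlg_mul, ← ofAlg_mul, ← ofAlg_mul, ← map_add, add_mul]

instance : NonUnitalNormedRing (CStarTensor A B) where
  __ := (inferInstance : NormedAddCommGroup (CStarTensor A B))
  __ := (inferInstance : NonUnitalRing (CStarTensor A B))
  norm_mul_le x y := by
    induction x, y using induction_on₂ with
    | hp => exact isClosed_le (by fun_prop) (by fun_prop)
    | h s t =>
      rw [← ofAlg_mul, norm_ofAlg, norm_ofAlg, norm_ofAlg]
      exact norm_mul_le s t

instance : StarRing (CStarTensor A B) where
  star_involutive x := by
    induction x using induction_on with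
    | hp => exact isClosed_eq (continuous_star'.comp continuous_star') continuous_id
    | h t => rw [← ofAlg_star, ← ofAlg_star, star_star]
  star_mul x y := by
    induction x, y using induction_on₂ with
    | hp =>
      exact isClosed_eq (continuous_star'.comp continuous_mul)
        ((continuous_star'.comp continuous_snd).mul (continuous_star'.comp continuous_fst))
    | h s t => rw [← ofAlg_mul, ← ofAlg_star, ← ofAlg_star, ← ofAlg_star, ← ofAlg_mul, star_mul]
  star_add x y := by
    induction x, y using induction_on₂ with
    | hp =>
      exact isClosed_eq (continuous_star'.comp continuous_add)
        ((continuous_star'.comp continuous_fst).add (continuous_star'.comp continuous_snd))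
    | h s t => rw [← map_add, ← ofAlg_star, ← ofAlg_star, ← ofAlg_star, ← map_add, star_add]

instance : CStarRing (CStarTensor A B) where
  norm_mul_self_le x := by
    induction x using induction_on with
    | hp => exact isClosed_le (by fun_prop) ((continuous_star'.mul continuous_id).norm)
    | h t =>
      rw [← ofAlg_star, ← ofAlg_mul, norm_ofAlg, norm_ofAlg, ← sq]
      exact sq_maxNorm_le (A := A) (B := B) t

instance : IsScalarTower ℂ (CStarTensor A B) (CStarTensor A B) where
  smul_assoc c x y := by
    change (c • x) * y = c • (x * y)
    induction x, y using induction_on₂ with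
    | hp =>
      exact isClosed_eq ((continuous_fst.const_smul c).mul continuous_snd)
        (continuous_mul.const_smul c)
    | h s t => rw [← map_smul, ← ofAlg_mul, ← ofAlg_mul, ← map_smul, smul_mul_assoc]

instance : SMulCommClass ℂ (CStarTensor A B) (CStarTensor A B) where
  smul_comm c x y := by
    change c • (x * y) = x * (c • y)
    induction x, y using induction_on₂ with
    | hp =>
      exact isClosed_eq (continuous_mul.const_smul c)
        (continuous_fst.mul (continuous_snd.const_smul c))
    | h s t => rw [← map_smul, ← ofAlg_mul, ← ofAlg_mul, ← map_smul, mul_smul_comm]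

instance : StarModule ℂ (CStarTensor A B) where
  star_smul c x := by
    induction x using induction_on with
    | hp =>
      exact isClosed_eq (continuous_star'.comp (continuous_const_smul c))
        (continuous_star'.const_smul (star c))
    | h t => rw [← map_smul, ← ofAlg_star, ← ofAlg_star, ← map_smul, star_smul]

/-- `A ⊗ B` is a C⋆-algebra. -/
instance : NonUnitalCStarAlgebra (CStarTensor A B) where

end

end CStarTensor

/-! ### Multipliers -/

section

open scoped MultiplierAlgebra

variable (B : Type*) [NonUnitalCStarAlgebra B]

/-- `LM(B)`: the left multipliers of `B`, that is, the bounded linear maps `T : B → B` with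
`T (x y) = T(x) y`. -/
def leftMultipliers : Set (B →L[ℂ] B) :=
  {T | ∀ x y : B, T (x * y) = T x * y}

/-- `M(B)` viewed inside `LM(B)`: the maps `x ↦ m x` on `B`, for `m` in the multiplier algebra
`𝓜(ℂ, B)` of double centralizers. -/
def multipliers : Set (B →L[ℂ] B) :=
  Set.range fun m : 𝓜(ℂ, B) => m.fst

end

/-! ### Hilbert modules

A (right) Hilbert `A`-module is a complete `CStarModule Aᵐᵒᵖ E`: an element `a : A` acts on the
right of `E` through `x <• a = MulOpposite.op a • x`, and the inner product is linear in its second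
variable and satisfies `⟪x, y <• a⟫ = ⟪x, y⟫ a` in `A`. -/

section

open scoped RightActions

variable (A : Type*) [NonUnitalCStarAlgebra A] [PartialOrder A]

/-- `B(E, F)`: the bounded module maps between two Hilbert `A`-modules. No adjoint is required. -/
def boundedModuleMaps (E F : Type*)
    [NormedAddCommGroup E] [NormedSpace ℂ E] [SMul Aᵐᵒᵖ E] [CStarModule Aᵐᵒᵖ E]
    [NormedAddCommGroup F] [NormedSpace ℂ F] [SMul Aᵐᵒᵖ F] [CStarModule Aᵐᵒᵖ F] :
    Set (E →L[ℂ] F) :=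
  {T | ∀ (x : E) (a : A), T (x <• a) = T x <• a}

/-- A Hilbert `A`-module `E` is countably generated if there is a countable set `S ⊆ E` for which
the linear span of the `x <• a`, with `x ∈ S` and `a ∈ A`, is dense in `E`. -/
def IsCountablyGenerated (E : Type*)
    [NormedAddCommGroup E] [NormedSpace ℂ E] [SMul Aᵐᵒᵖ E] [CStarModule Aᵐᵒᵖ E] : Prop :=
  ∃ S : Set E, S.Countable ∧
    Dense (Submodule.span ℂ {y : E | ∃ x ∈ S, ∃ a : A, y = x <• a} : Set E)

/-- A Hilbert `A`-module `H` is projective, with bounded module maps as morphisms, if every bounded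
module map `ψ : H → H₂` lifts through every surjective bounded module map `φ : H₁ → H₂`. -/
def IsProjectiveHilbertModule (A : Type u) [NonUnitalCStarAlgebra A] [PartialOrder A]
    (H : Type v) [NormedAddCommGroup H] [NormedSpace ℂ H] [SMul Aᵐᵒᵖ H] [CStarModule Aᵐᵒᵖ H] :
    Prop :=
  ∀ (H₁ : Type w₁) [NormedAddCommGroup H₁] [NormedSpace ℂ H₁] [SMul Aᵐᵒᵖ H₁]
    [CStarModule Aᵐᵒᵖ H₁] [CompleteSpace H₁]
    (H₂ : Type w₂) [NormedAddCommGroup H₂] [NormedSpace ℂ H₂] [SMul Aᵐᵒᵖ H₂]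
    [CStarModule Aᵐᵒᵖ H₂] [CompleteSpace H₂],
    ∀ φ ∈ boundedModuleMaps A H₁ H₂, Function.Surjective φ →
      ∀ ψ ∈ boundedModuleMaps A H H₂,
        ∃ χ ∈ boundedModuleMaps A H H₁, φ ∘L χ = ψ

end

end

/-! Let `φ : E → F` be the surjection and `ψ : H → F` the map to be lifted. If `φ` had an adjoint,
then `φ φ*` would be invertible and `φ* (φ φ*)⁻¹ ψ` would be a lift. A bounded module map need not
have an adjoint, but separability reduces the problem to countably generated pieces, where the
hypothesis on `A ⊗ 𝒦` provides one.

Since `H` is separable, so is `N`, the closure of `ψ(H)`. Lift a dense sequence of `N` through `φ`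
with norm control (open mapping theorem) and let `K ⊆ E` be the closed submodule generated by the
lifts. Suppose `S : F → K` satisfies `⟪S y, z⟫ = ⟪y, φ z⟫` for `z ∈ K`. The norm control makes `S`
bounded below on `N`, so the positive operator `φ S` is bounded below on `N` and hence invertible
there, and `S (φ S)⁻¹ ψ` is the lift (`exists_lift_of_leftMultipliers_eq`).

To construct `S`, one needs for a bounded module map `f : E → A` and `a' ∈ A` an element `e ∈ K`
with `⟪e, z⟫ = a' f(z)` on `K` (`exists_inner_eq_of_leftMultipliers_eq`). The submodule `K` has a
countable Parseval frame `(y_k)`: `∑ y_k ⟪y_k, z⟫ = z` on `K`. The maps `g_k(a) = f(y_k a)` are left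
multipliers of `A`, and together they form a bounded row, that is, a left multiplier of `A ⊗ 𝒦`
supported in row `0`. If it is a multiplier, its product on the left with `a' ⊗ e₀₀` is an element
of `A ⊗ 𝒦`, whose entries `r_k` satisfy `r_k a = a' g_k(a)` and have `∑ r_k r_k*` norm convergent
(`exists_row_of_leftMultipliers_eq`). Then `e = ∑ y_k r_k*` converges and represents `a' f`. The
factor `a'` is removed with an approximate unit.

The frame comes from the frame operator `θ` of a square summable generating sequence `(x_n)` and the
iteration `r₀ = 1`, `r_{m+1} = r_m - r_m θ r_m`. The sum of `r_m θ r_m` over `m < M` telescopes to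
`1 - r_M`, and `r_M → 0` on `K`, so the vectors `r_m(θ) x_n` form the frame. The same polynomials
invert `φ S` on `N`. -/

set_option linter.unusedSectionVars false

noncomputable section

/-! ### Positive functionals and GNS representations that attain the norm -/

section States

open scoped ComplexOrder CStarAlgebra

/-- A nonnegative element of a unital C⋆-algebra is normed by a real-linear functional which is
nonnegative on the positive cone and normalised at `1`. -/
theorem exists_real_state {B : Type*} [CStarAlgebra B] [PartialOrder B] [StarOrderedRing B]
    [Nontrivial B] {b : B} (hb : 0 ≤ b) :
    ∃ g : selfAdjoint B →ₗ[ℝ] ℝ, g 1 = 1 ∧ g ⟨b, hb.isSelfAdjoint⟩ = ‖b‖ ∧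
      ∀ x : selfAdjoint B, 0 ≤ (x : B) → 0 ≤ g x := by
  set b' : selfAdjoint B := ⟨b, hb.isSelfAdjoint⟩ with hb'
  -- The norm of `b` lies in its spectrum, so spectral mapping puts `s + t‖b‖` in the spectrum of `s
  -- + t b`. This gives both the well-definedness and the positivity of `s + t b ↦ s + t‖b‖` on the
  -- span of `1` and `b`.
  have hspec : ∀ s t : ℝ, s + t * ‖b‖ ∈ spectrum ℝ (s • (1 : B) + t • b) := by
    intro s t
    have h := spectrum.subset_polynomial_aeval b
      (Polynomial.C s + Polynomial.C t * Polynomial.X : Polynomial ℝ)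
      ⟨‖b‖, CStarAlgebra.norm_mem_spectrum_of_nonneg hb, rfl⟩
    simpa [Algebra.algebraMap_eq_smul_one] using h
  let W : ℝ × ℝ →ₗ[ℝ] selfAdjoint B :=
    (LinearMap.toSpanSingleton ℝ _ 1).coprod (LinearMap.toSpanSingleton ℝ _ b')
  let l : ℝ × ℝ →ₗ[ℝ] ℝ := LinearMap.id.coprod (LinearMap.toSpanSingleton ℝ _ ‖b‖)
  have hW : ∀ p : ℝ × ℝ, ((W p : selfAdjoint B) : B) = p.1 • (1 : B) + p.2 • b := by
    intro p; simp [W, hb']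
  have hl : ∀ p : ℝ × ℝ, l p = p.1 + p.2 * ‖b‖ := by intro p; simp [l]
  -- `1` and `b` may be linearly dependent, so the functional is defined on the quotient by the
  -- relations between them.
  have hker : LinearMap.ker W ≤ LinearMap.ker l := by
    intro p hp
    have h1 := hspec p.1 p.2
    rw [← hW, LinearMap.mem_ker.1 hp] at h1
    simp only [ZeroMemClass.coe_zero, spectrum.zero_eq, Set.mem_singleton_iff] at h1
    rw [LinearMap.mem_ker, hl, h1]
  let f : selfAdjoint B →ₗ.[ℝ] ℝ :=
    ⟨LinearMap.range W, (LinearMap.ker W).liftQ l hker ∘ₗ W.quotKerEquivRange.symm.toLinearMap⟩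
  have hf : ∀ p : ℝ × ℝ, f ⟨W p, LinearMap.mem_range_self W p⟩ = l p := by
    intro p
    change (LinearMap.ker W).liftQ l hker (W.quotKerEquivRange.symm _) = _
    rw [LinearMap.quotKerEquivRange_symm_apply_image W p (LinearMap.mem_range_self W p)]
    simp
  let C : PointedCone ℝ (selfAdjoint B) :=
    { carrier := {x | 0 ≤ (x : B)}
      add_mem' := fun {x y} hx hy => by
        simpa using add_nonneg (show 0 ≤ (x : B) from hx) (show 0 ≤ (y : B) from hy)
      zero_mem' := by simp
      smul_mem' := fun c x hx => by
        have : 0 ≤ (c : ℝ) • (x : B) := smul_nonneg c.2 hx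
        exact this }
  -- The M. Riesz extension theorem applies because `‖y‖ • 1 + y` is nonnegative for every
  -- self-adjoint `y`.
  obtain ⟨g, hg, hgC⟩ := riesz_extension C f
    (by
      rintro ⟨_, p, rfl⟩ hx
      rw [hf, hl]
      have hx' : 0 ≤ p.1 • (1 : B) + p.2 • b := by rw [← hW]; exact hx
      exact spectrum_nonneg_of_nonneg hx' (hspec p.1 p.2))
    (by
      intro y
      refine ⟨⟨W (‖(y : B)‖, 0), LinearMap.mem_range_self W _⟩, ?_⟩
      change 0 ≤ ((W (‖(y : B)‖, 0) + y : selfAdjoint B) : B)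
      rw [AddSubgroup.coe_add, hW]
      have h := IsSelfAdjoint.neg_algebraMap_norm_le_self y.2
      rw [Algebra.algebraMap_eq_smul_one] at h
      simpa using neg_le_iff_add_nonneg'.1 h)
  have e1 : W (1, 0) = 1 := by simp [W]
  have e2 : W (0, 1) = b' := by simp [W]
  refine ⟨g, ?_, ?_, hgC⟩
  · have := hg ⟨W (1, 0), LinearMap.mem_range_self W _⟩
    rw [hf, hl] at this
    simpa [e1] using this
  · have := hg ⟨W (0, 1), LinearMap.mem_range_self W _⟩
    rw [hf, hl] at this
    simpa [e2] using this

/-- A nonnegative element of a C⋆-algebra is normed by a positive functional, which satisfies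
`f(b)² ≤ f(b²)` at this element. -/
theorem exists_positive_functional {A : Type*} [NonUnitalCStarAlgebra A] [PartialOrder A]
    [StarOrderedRing A] {b : A} (hb : 0 ≤ b) :
    ∃ f : A →ₚ[ℂ] ℂ, f b = ‖b‖ ∧ ‖b‖ ^ 2 ≤ (f (b * b)).re := by
  have hb1 : 0 ≤ (b : Unitization ℂ A) := Unitization.inr_nonneg_iff.2 hb
  obtain ⟨g, hg1, hgb, hg⟩ := exists_real_state hb1
  let F : Unitization ℂ A →ₗ[ℂ] ℂ :=
    { toFun := fun x => (g (realPart x) : ℂ) + Complex.I * g (imaginaryPart x)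
      map_add' := fun x y => by simp; ring
      map_smul' := fun c x => by
        apply Complex.ext
        · simp [realPart_smul, imaginaryPart_smul]
        · simp [realPart_smul, imaginaryPart_smul] }
  have hF : ∀ x : Unitization ℂ A, ∀ hx : IsSelfAdjoint x, F x = g ⟨x, hx⟩ := by
    intro x hx
    have h1 : realPart x = ⟨x, hx⟩ := Subtype.ext hx.coe_realPart
    have h2 : imaginaryPart x = 0 := hx.imaginaryPart
    simp [F, h1, h2]
  let f : A →ₗ[ℂ] ℂ := F ∘ₗ
    { toFun := fun a => (a : Unitization ℂ A)
      map_add' := fun x y => Unitization.inr_add ℂ x y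
      map_smul' := fun c x => Unitization.inr_smul ℂ c x }
  have hf : ∀ x : A, f x = F (x : Unitization ℂ A) := fun x => rfl
  refine ⟨PositiveLinearMap.mk₀ f ?_, ?_, ?_⟩
  · intro x hx
    have hx1 : 0 ≤ (x : Unitization ℂ A) := Unitization.inr_nonneg_iff.2 hx
    rw [hf, hF _ hx1.isSelfAdjoint]
    exact_mod_cast hg _ hx1
  · change f b = _
    rw [hf, hF _ hb1.isSelfAdjoint, hgb, Unitization.norm_inr]
  · change ‖b‖ ^ 2 ≤ (f (b * b)).re
    have hbb : IsSelfAdjoint ((b * b : A) : Unitization ℂ A) := by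
      rw [Unitization.inr_mul]; exact hb1.isSelfAdjoint.commute_iff hb1.isSelfAdjoint |>.1 rfl
    rw [hf, hF _ hbb, Complex.ofReal_re]
    -- Positivity of `(b - ‖b‖)²` yields `g(b²) ≥ 2‖b‖ g(b) - ‖b‖² = ‖b‖²`.
    have h2 := hg (⟨_, hbb⟩ - (2 * ‖b‖) • ⟨_, hb1.isSelfAdjoint⟩ + (‖b‖ ^ 2) • 1) (by
      have h3 : IsSelfAdjoint ((b : Unitization ℂ A) - ‖b‖ • 1) :=
        hb1.isSelfAdjoint.sub ((IsSelfAdjoint.all ‖b‖).smul (IsSelfAdjoint.one _))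
      have h4 := h3.mul_self_nonneg
      have h5 : ((b : Unitization ℂ A) - ‖b‖ • 1) * ((b : Unitization ℂ A) - ‖b‖ • 1)
          = ((b * b : A) : Unitization ℂ A) - (2 * ‖b‖) • (b : Unitization ℂ A)
            + (‖b‖ ^ 2) • 1 := by
        rw [Unitization.inr_mul]
        simp only [mul_sub, sub_mul, smul_mul_assoc, mul_smul_comm, one_mul, mul_one, smul_sub]
        module
      rw [h5] at h4
      simpa using h4)
    rw [map_add, map_sub, map_smul, map_smul, hg1, hgb, Unitization.norm_inr] at h2
    simp only [smul_eq_mul] at h2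
    nlinarith

/-- The GNS representations of the positive functionals norm every element. -/
theorem exists_norm_le_norm_gns {A : Type*} [NonUnitalCStarAlgebra A] [PartialOrder A]
    [StarOrderedRing A] (c : A) :
    ∃ f : A →ₚ[ℂ] ℂ, ‖c‖ ≤ ‖f.gnsNonUnitalStarAlgHom c‖ := by
  set b : A := star c * c with hbdef
  have hb : 0 ≤ b := star_mul_self_nonneg c
  have hbs : star b = b := hb.isSelfAdjoint
  obtain ⟨f, hfb, hf⟩ := exists_positive_functional hb
  refine ⟨f, ?_⟩
  have hN : ‖b‖ = ‖c‖ ^ 2 := by rw [hbdef, CStarRing.norm_star_mul_self, sq]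
  rcases eq_or_ne c 0 with rfl | hc
  · simp
  have hNpos : 0 < ‖b‖ := by rw [hN]; positivity
  set p := ‖f.gnsNonUnitalStarAlgHom c‖
  set v := f.toPreGNS b
  -- Without a unit there is no obvious cyclic vector, so `π(c)` is tested on the class `v` of `b =
  -- c* c`. From `f(b²) = ⟪[c], π(c) v⟫` follows `‖v‖ ≤ ‖[c]‖ p`, while `‖[c]‖² = ‖b‖` and `‖v‖² ≥
  -- ‖b‖²`.
  have e1 : ‖f.toPreGNS (c * b)‖ ≤ p * ‖v‖ := by
    have h := (f.gnsNonUnitalStarAlgHom c).le_opNorm (v : f.GNS)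
    simpa [v] using h
  have e2 : ‖v‖ ^ 2 = (f (b * b)).re := by
    have := f.preGNS_norm_sq v
    simp only [v, PositiveLinearMap.ofPreGNS_toPreGNS, hbs] at this
    rw [← this]; norm_cast
  have e3 : ‖f.toPreGNS c‖ ^ 2 = ‖b‖ := by
    have := f.preGNS_norm_sq (f.toPreGNS c)
    simp only [PositiveLinearMap.ofPreGNS_toPreGNS, ← hbdef, hfb] at this
    exact_mod_cast this
  have e4 : (f (b * b)).re ≤ ‖f.toPreGNS c‖ * ‖f.toPreGNS (c * b)‖ := by
    have h := re_inner_le_norm (𝕜 := ℂ) (f.toPreGNS c) (f.toPreGNS (c * b))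
    rw [PositiveLinearMap.preGNS_inner_def] at h
    simpa [← mul_assoc, ← hbdef] using h
  have hv : 0 < ‖v‖ := by
    have : 0 < ‖v‖ ^ 2 := by rw [e2]; exact lt_of_lt_of_le (by positivity) hf
    exact lt_of_le_of_ne (norm_nonneg _) fun h => by simp [← h] at this
  have e5 : ‖v‖ ≤ ‖f.toPreGNS c‖ * p := by
    have : ‖v‖ * ‖v‖ ≤ (‖f.toPreGNS c‖ * p) * ‖v‖ := by
      calc ‖v‖ * ‖v‖ = (f (b * b)).re := by rw [← e2, sq]
        _ ≤ _ := e4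
        _ ≤ ‖f.toPreGNS c‖ * (p * ‖v‖) := by gcongr
        _ = _ := by ring
    exact le_of_mul_le_mul_right this hv
  have e6 : ‖b‖ ^ 2 ≤ ‖b‖ * p ^ 2 := by
    calc ‖b‖ ^ 2 ≤ ‖v‖ ^ 2 := by rw [e2]; exact hf
      _ ≤ (‖f.toPreGNS c‖ * p) ^ 2 := by gcongr
      _ = ‖b‖ * p ^ 2 := by rw [mul_pow, e3]
  have e7 : ‖c‖ ^ 2 ≤ p ^ 2 := by
    rw [← hN]; rw [sq] at e6; exact le_of_mul_le_mul_left e6 hNpos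
  exact le_of_sq_le_sq e7 (norm_nonneg _)

end States

/-! ### The representations `π ⊗ id` and the norm of elementary tensors in `A ⊗ 𝒦` -/

namespace CompactsEllTwo

/-- The inclusion of `𝒦` in the bounded operators on `ℓ²`. -/
def toCLM (k : CompactsEllTwo) : EllTwo →L[ℂ] EllTwo := Subtype.val (p := (· ∈ compactsEllTwo)) k

theorem toCLM_injective : Function.Injective toCLM := fun _ _ h => Subtype.ext h
theorem toCLM_add (k l : CompactsEllTwo) : toCLM (k + l) = toCLM k + toCLM l := rfl
theorem toCLM_sub (k l : CompactsEllTwo) : toCLM (k - l) = toCLM k - toCLM l := rfl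
theorem toCLM_smul (c : ℂ) (k : CompactsEllTwo) : toCLM (c • k) = c • toCLM k := rfl
theorem toCLM_zero : toCLM 0 = 0 := rfl
theorem toCLM_mul (k l : CompactsEllTwo) : toCLM (k * l) = toCLM k ∘L toCLM l := rfl
theorem toCLM_star (k : CompactsEllTwo) :
    toCLM (star k) = ContinuousLinearMap.adjoint (toCLM k) := rfl
theorem norm_toCLM (k : CompactsEllTwo) : ‖toCLM k‖ = ‖k‖ := rfl
theorem isCompactOperator_toCLM (k : CompactsEllTwo) : IsCompactOperator (toCLM k) := k.2

end CompactsEllTwo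

namespace CStarTensor

section

variable {A : Type*} [NonUnitalCStarAlgebra A] {G : Type*} [NormedAddCommGroup G]
  [InnerProductSpace ℂ G] [CompleteSpace G] (π : A →⋆ₙₐ[ℂ] (G →L[ℂ] G))

open CompactsEllTwo

/-- The representation `π ⊗ id` of `A ⊙ 𝒦` on `G ⊙ ℓ²` attached to a representation `π` of `A`. -/
def tensorRep : A ⊗[ℂ] CompactsEllTwo →ₗ[ℂ] (G ⊗[ℂ] EllTwo →L[ℂ] G ⊗[ℂ] EllTwo) :=
  TensorProduct.lift <| LinearMap.mk₂ ℂ (fun a k => TensorProduct.mapL (π a) (toCLM k))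
    (fun a b k => by rw [map_add, TensorProduct.mapL_add_left])
    (fun c a k => by rw [map_smul, TensorProduct.mapL_smul_left])
    (fun a k l => by rw [toCLM_add, TensorProduct.mapL_add_right])
    (fun c a k => by rw [toCLM_smul, TensorProduct.mapL_smul_right])

theorem tensorRep_tmul (a : A) (k : CompactsEllTwo) :
    tensorRep π (a ⊗ₜ k) = TensorProduct.mapL (π a) (toCLM k) := rfl

theorem tensorRep_mul (s t : A ⊗[ℂ] CompactsEllTwo) :
    tensorRep π (s * t) = tensorRep π s ∘L tensorRep π t := by
  induction s with
  | zero => simp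
  | add s₁ s₂ h₁ h₂ => rw [add_mul, map_add, h₁, h₂, map_add, ContinuousLinearMap.add_comp]
  | tmul a k =>
    induction t with
    | zero => simp
    | add t₁ t₂ h₁ h₂ => rw [mul_add, map_add, h₁, h₂, map_add, ContinuousLinearMap.comp_add]
    | tmul b l =>
      rw [Algebra.TensorProduct.tmul_mul_tmul, tensorRep_tmul, tensorRep_tmul, tensorRep_tmul,
        map_mul, toCLM_mul, ← TensorProduct.mapL_comp]
      rfl

/-- The space `G ⊙ ℓ²` is not completed, so adjoints of bounded operators on it need not exist. This
relation is all that the C⋆-inequality requires of them. -/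
theorem inner_tensorRep_star (t : A ⊗[ℂ] CompactsEllTwo) (x y : G ⊗[ℂ] EllTwo) :
    inner ℂ (tensorRep π (star t) x) y = inner ℂ x (tensorRep π t y) := by
  induction t with
  | zero => simp
  | add s₁ s₂ h₁ h₂ => simp [h₁, h₂, inner_add_left, inner_add_right]
  | tmul a k =>
    induction x with
    | zero => simp
    | add x₁ x₂ h₁ h₂ => rw [map_add, inner_add_left, inner_add_left, h₁, h₂]
    | tmul x₁ x₂ =>
      induction y with
      | zero => simp
      | add y₁ y₂ h₁ h₂ => rw [map_add, inner_add_right, inner_add_right, h₁, h₂]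
      | tmul y₁ y₂ =>
        rw [TensorProduct.star_tmul, tensorRep_tmul, tensorRep_tmul, TensorProduct.mapL_tmul,
          TensorProduct.mapL_tmul, TensorProduct.inner_tmul, TensorProduct.inner_tmul, map_star,
          toCLM_star, ContinuousLinearMap.star_eq_adjoint,
          ContinuousLinearMap.adjoint_inner_left, ContinuousLinearMap.adjoint_inner_left]

theorem sq_norm_tensorRep_le (t : A ⊗[ℂ] CompactsEllTwo) :
    ‖tensorRep π t‖ ^ 2 ≤ ‖tensorRep π (star t * t)‖ := by
  have h : ‖tensorRep π t‖ ≤ √‖tensorRep π (star t * t)‖ := by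
    refine ContinuousLinearMap.opNorm_le_bound _ (Real.sqrt_nonneg _) fun x => ?_
    refine le_of_sq_le_sq ?_ (by positivity)
    rw [mul_pow, Real.sq_sqrt (ContinuousLinearMap.opNorm_nonneg _)]
    have h1 := inner_tensorRep_star π t (tensorRep π t x) x
    have h2 := inner_self_eq_norm_sq_to_K (𝕜 := ℂ) (tensorRep π t x)
    have h3 := norm_inner_le_norm (𝕜 := ℂ) (tensorRep π (star t * t) x) x
    rw [tensorRep_mul, ContinuousLinearMap.comp_apply, h1, h2] at h3
    have h4 := (tensorRep π (star t * t)).le_opNorm x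
    rw [tensorRep_mul, ContinuousLinearMap.comp_apply] at h4
    calc ‖tensorRep π t x‖ ^ 2 = ‖((‖tensorRep π t x‖ : ℂ)) ^ 2‖ := by simp
      _ ≤ _ := h3
      _ ≤ _ := mul_le_mul_of_nonneg_right h4 (norm_nonneg x)
      _ = _ := by rw [tensorRep_mul]; ring
  calc _ ≤ √‖tensorRep π (star t * t)‖ ^ 2 := by gcongr
    _ = _ := Real.sq_sqrt (ContinuousLinearMap.opNorm_nonneg _)

theorem norm_tensorRep_mul_le (s t : A ⊗[ℂ] CompactsEllTwo) :
    ‖tensorRep π (s * t)‖ ≤ ‖tensorRep π s‖ * ‖tensorRep π t‖ := by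
  rw [tensorRep_mul]; exact ContinuousLinearMap.opNorm_comp_le _ _

theorem norm_tensorRep_star_le (t : A ⊗[ℂ] CompactsEllTwo) :
    ‖tensorRep π (star t)‖ ≤ ‖tensorRep π t‖ := by
  have h1 := sq_norm_tensorRep_le π (star t)
  rw [star_star] at h1
  have h2 := norm_tensorRep_mul_le π t (star t)
  have h3 := norm_nonneg (tensorRep π (star t))
  have h4 := norm_nonneg (tensorRep π t)
  by_contra! h
  nlinarith

/-- Every representation of `A` thus bounds the norm of `A ⊗ 𝒦`, a supremum of C⋆-seminorms, from
below. -/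
theorem isCStarSeminorm_tensorRep :
    IsCStarSeminorm ((normSeminorm ℂ (G ⊗[ℂ] EllTwo →L[ℂ] G ⊗[ℂ] EllTwo)).comp (tensorRep π)) where
  mul_le := norm_tensorRep_mul_le π
  star_mul_self t := by
    refine le_antisymm ?_ (sq_norm_tensorRep_le π t)
    refine (norm_tensorRep_mul_le π _ _).trans ?_
    rw [sq]
    exact mul_le_mul_of_nonneg_right (norm_tensorRep_star_le π t)
      (ContinuousLinearMap.opNorm_nonneg _)
  tmul_le a k := by
    refine (TensorProduct.norm_mapL_le (π a) (toCLM k)).trans ?_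
    rw [norm_toCLM]
    exact mul_le_mul_of_nonneg_right (NonUnitalStarAlgHom.norm_apply_le π a) (norm_nonneg _)

/-- The elementary tensor `a ⊗ b` in `A ⊗ B`. -/
def tmul {A B : Type*} [NonUnitalCStarAlgebra A] [NonUnitalCStarAlgebra B] (a : A) (b : B) :
    CStarTensor A B :=
  ofAlg (A := A) (B := B) (a ⊗ₜ[ℂ] b : A ⊗[ℂ] B)

/-- `‖a‖ ‖k‖ ≤ ‖a ⊗ k‖` in `A ⊗ 𝒦`. -/
theorem norm_mul_le_norm_tmul [PartialOrder A] [StarOrderedRing A] (a : A) (k : CompactsEllTwo) :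
    ‖a‖ * ‖k‖ ≤ ‖tmul a k‖ := by
  obtain ⟨f, hf⟩ := exists_norm_le_norm_gns a
  set π := f.gnsNonUnitalStarAlgHom
  have h1 := le_maxNorm (isCStarSeminorm_tensorRep π) (a ⊗ₜ[ℂ] k)
  have h2 : ‖tmul a k‖ = maxNorm (a ⊗ₜ[ℂ] k) := norm_ofAlg _
  rw [h2]
  refine le_trans ?_ h1
  change _ ≤ ‖tensorRep π (a ⊗ₜ k)‖
  rw [tensorRep_tmul, ← norm_toCLM]
  refine (mul_le_mul_of_nonneg_right hf (ContinuousLinearMap.opNorm_nonneg (toCLM k))).trans ?_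
  set T := TensorProduct.mapL (π a) (toCLM k)
  -- Testing on elementary vectors `x ⊗ y` is enough. The bound on `‖π a‖ ‖k‖` follows by taking
  -- suprema over `x` and then `y`, after the vanishing factors are set aside.
  have h3 : ∀ x y, ‖π a x‖ * ‖toCLM k y‖ ≤ ‖T‖ * ‖x‖ * ‖y‖ := by
    intro x y
    have := T.le_opNorm (x ⊗ₜ y)
    rw [TensorProduct.mapL_tmul, TensorProduct.norm_tmul, TensorProduct.norm_tmul] at this
    linarith
  rcases (norm_nonneg (toCLM k)).eq_or_lt with h | h
  · rw [← h, mul_zero]; exact ContinuousLinearMap.opNorm_nonneg T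
  rw [← le_div_iff₀ h]
  refine ContinuousLinearMap.opNorm_le_bound _ (by positivity) fun x => ?_
  rw [div_mul_eq_mul_div, le_div_iff₀ h, mul_comm]
  rcases (norm_nonneg (π a x)).eq_or_lt with h' | h'
  · rw [← h', mul_zero]; positivity
  rw [← le_div_iff₀ h']
  refine ContinuousLinearMap.opNorm_le_bound _ (by positivity) fun y => ?_
  rw [div_mul_eq_mul_div, le_div_iff₀ h', mul_comm]
  exact h3 x y

end

end CStarTensor

/-! ### Rank one operators, matrix units and their density in `𝒦` -/

namespace CompactsEllTwo

/-- The rank one operator `z ↦ ⟪y, z⟫ x` as an element of `𝒦`. -/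
def rankOne (x y : EllTwo) : CompactsEllTwo :=
  ⟨InnerProductSpace.rankOne ℂ x y,
    ((isCompactOperator_of_locallyCompactSpace_dom (innerSL ℂ y)).clm_comp
      (ContinuousLinearMap.toSpanSingleton ℂ x) :)⟩

theorem toCLM_rankOne (x y : EllTwo) : toCLM (rankOne x y) = InnerProductSpace.rankOne ℂ x y := rfl

theorem norm_rankOne (x y : EllTwo) : ‖rankOne x y‖ = ‖x‖ * ‖y‖ :=
  InnerProductSpace.norm_rankOne x y

theorem rankOne_mul_rankOne (x y z w : EllTwo) :
    rankOne x y * rankOne z w = inner ℂ y z • rankOne x w :=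
  toCLM_injective (InnerProductSpace.rankOne_comp_rankOne x y z w)

theorem star_rankOne (x y : EllTwo) : star (rankOne x y) = rankOne y x :=
  toCLM_injective (by rw [toCLM_star, toCLM_rankOne, InnerProductSpace.adjoint_rankOne]; rfl)

theorem continuous_rankOne_left (y : EllTwo) : Continuous fun x => rankOne x y := by
  refine Continuous.subtype_mk ?_ _
  exact ((InnerProductSpace.rankOne ℂ (E := EllTwo) (F := EllTwo)).flip y).continuous

theorem continuous_rankOne_right (x : EllTwo) : Continuous fun y => rankOne x y := by
  refine Continuous.subtype_mk ?_ _
  exact (InnerProductSpace.rankOne ℂ (E := EllTwo) (F := EllTwo) x).continuous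

/-- The standard basis vectors of `ℓ²(ℕ)`. -/
def basisVec (i : ℕ) : EllTwo := lp.single 2 i 1

theorem inner_basisVec (i j : ℕ) : inner ℂ (basisVec i) (basisVec j) = if i = j then (1 : ℂ) else 0 := by
  rw [basisVec, lp.inner_single_left, basisVec, lp.single_apply]
  split_ifs with h
  · subst h; simp
  · simp [Pi.single_eq_of_ne h]

theorem norm_basisVec (i : ℕ) : ‖basisVec i‖ = 1 := by
  rw [basisVec, lp.norm_single (by norm_num)]; simp

theorem hasSum_basisVec (x : EllTwo) : HasSum (fun i => x i • basisVec i) x := by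
  have := lp.hasSum_single (p := 2) (by norm_num) x
  convert this using 2 with i
  rw [basisVec, ← lp.single_smul]; simp

/-- The matrix units of `𝒦`. -/
def matrixUnit (i j : ℕ) : CompactsEllTwo := rankOne (basisVec i) (basisVec j)

theorem matrixUnit_mul (i j k l : ℕ) :
    matrixUnit i j * matrixUnit k l = if j = k then matrixUnit i l else 0 := by
  rw [matrixUnit, matrixUnit, rankOne_mul_rankOne, inner_basisVec]
  split_ifs <;> simp [matrixUnit]

theorem matrixUnit_mul_same (i j l : ℕ) :
    matrixUnit i j * matrixUnit j l = matrixUnit i l := by simp [matrixUnit_mul]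

theorem star_matrixUnit (i j : ℕ) : star (matrixUnit i j) = matrixUnit j i := star_rankOne _ _

theorem norm_matrixUnit (i j : ℕ) : ‖matrixUnit i j‖ = 1 := by
  rw [matrixUnit, norm_rankOne, norm_basisVec, norm_basisVec, one_mul]

/-- Stated for a predicate so that it serves both slots of `rankOne`, one linear and one conjugate
linear. -/
theorem mem_of_tendsto_basis {p : EllTwo → Prop} (h0 : p 0) (hadd : ∀ x y, p x → p y → p (x + y))
    (hsmul : ∀ (c : ℂ) x, p x → p (c • x)) (hcl : IsClosed {x | p x}) (h : ∀ i, p (basisVec i))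
    (x : EllTwo) : p x := by
  refine hcl.mem_of_tendsto (hasSum_basisVec x) (Filter.Eventually.of_forall fun s => ?_)
  exact Finset.sum_induction _ p hadd h0 fun i _ => hsmul _ _ (h i)

/-- The matrix units span a dense subspace of `𝒦`. -/
theorem mem_of_isClosed (M : Submodule ℂ CompactsEllTwo)
    (hM : IsClosed (M : Set CompactsEllTwo)) (h : ∀ i j, matrixUnit i j ∈ M)
    (k : CompactsEllTwo) : k ∈ M := by
  have h1 : ∀ i y, rankOne (basisVec i) y ∈ M := fun i y => by
    refine mem_of_tendsto_basis (p := fun y => rankOne (basisVec i) y ∈ M) ?_ ?_ ?_ ?_ (h i) y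
    · have : rankOne (basisVec i) 0 = 0 := toCLM_injective (by simp [toCLM_rankOne, toCLM_zero])
      rw [this]; exact M.zero_mem
    · intro x y hx hy
      have : rankOne (basisVec i) (x + y) = rankOne (basisVec i) x + rankOne (basisVec i) y :=
        toCLM_injective (by simp [toCLM_rankOne, toCLM_add])
      rw [this]; exact M.add_mem hx hy
    · intro c x hx
      have : rankOne (basisVec i) (c • x) = star c • rankOne (basisVec i) x :=
        toCLM_injective (by simp [toCLM_rankOne, toCLM_smul])
      rw [this]; exact M.smul_mem _ hx
    · exact hM.preimage (continuous_rankOne_right _)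
  have h2 : ∀ x y, rankOne x y ∈ M := fun x y => by
    refine mem_of_tendsto_basis (p := fun x => rankOne x y ∈ M) ?_ ?_ ?_ ?_ (fun i => h1 i y) x
    · have : rankOne 0 y = 0 := toCLM_injective (by simp [toCLM_rankOne, toCLM_zero])
      rw [this]; exact M.zero_mem
    · intro x x' hx hy
      have : rankOne (x + x') y = rankOne x y + rankOne x' y :=
        toCLM_injective (by simp [toCLM_rankOne, toCLM_add])
      rw [this]; exact M.add_mem hx hy
    · intro c x hx
      have : rankOne (c • x) y = c • rankOne x y :=
        toCLM_injective (by simp [toCLM_rankOne, toCLM_smul])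
      rw [this]; exact M.smul_mem _ hx
    · exact hM.preimage (continuous_rankOne_left _)
  rw [← SetLike.mem_coe, ← hM.closure_eq, Metric.mem_closure_iff]
  intro ε hε
  -- The image of the unit ball has a finite `ε / 2`-net. The projection onto the span of the net
  -- moves each `k x` with `‖x‖ ≤ 1` by at most `ε / 2`, and its composite with `k` is a finite sum
  -- of rank one operators.
  have hc : TotallyBounded (toCLM k '' Metric.closedBall 0 1) :=
    ((isCompactOperator_toCLM k).isCompact_closure_image_closedBall
      (f := (toCLM k : EllTwo →ₗ[ℂ] EllTwo)) 1).totallyBounded.subset subset_closure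
  obtain ⟨t, htf, ht⟩ := Metric.totallyBounded_iff.1 hc (ε / 2) (by positivity)
  set U : Submodule ℂ EllTwo := Submodule.span ℂ t
  have : FiniteDimensional ℂ U := FiniteDimensional.span_of_finite ℂ htf
  set b := stdOrthonormalBasis ℂ U
  refine ⟨∑ i, rankOne (b i : EllTwo) (ContinuousLinearMap.adjoint (toCLM k) (b i)),
    M.sum_mem fun i _ => h2 _ _, ?_⟩
  have e1 : toCLM (∑ i, rankOne (b i : EllTwo) (ContinuousLinearMap.adjoint (toCLM k) (b i)))
      = U.starProjection ∘L toCLM k := by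
    rw [b.starProjection_eq_sum_rankOne]
    have : toCLM (∑ i, rankOne (b i : EllTwo) (ContinuousLinearMap.adjoint (toCLM k) (b i)))
        = ∑ i, toCLM (rankOne (b i : EllTwo) (ContinuousLinearMap.adjoint (toCLM k) (b i))) :=
      map_sum (AddMonoidHom.mk' toCLM toCLM_add) _ _
    rw [this]
    ext1 x
    simp [toCLM_rankOne, ContinuousLinearMap.adjoint_inner_left]
  rw [dist_eq_norm, ← norm_toCLM, toCLM_sub, e1]
  refine lt_of_le_of_lt (ContinuousLinearMap.opNorm_le_of_unit_norm (𝕜 := ℂ) (C := ε / 2)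
    (by positivity) fun x hx => ?_) (half_lt_self hε)
  obtain ⟨y, hy, hxy⟩ := Set.mem_iUnion₂.1 (ht ⟨x, by simp [hx], rfl⟩)
  change ‖toCLM k x - U.starProjection (toCLM k x)‖ ≤ ε / 2
  rw [Submodule.starProjection_minimal]
  refine (ciInf_le ⟨0, by rintro _ ⟨z, rfl⟩; exact norm_nonneg _⟩
    (⟨y, Submodule.subset_span hy⟩ : U)).trans ?_
  rw [Metric.mem_ball, dist_eq_norm] at hxy
  exact hxy.le

end CompactsEllTwo

/-! ### Matrices, rows and columns over `A` inside `A ⊗ 𝒦` -/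

namespace CStarTensor

section

open CompactsEllTwo

variable {A : Type*} [NonUnitalCStarAlgebra A]

section Tmul

variable {B : Type*} [NonUnitalCStarAlgebra B]

/-- The bilinear map `(a, b) ↦ a ⊗ b` into the C⋆-tensor product. -/
def tmulₗ : A →ₗ[ℂ] B →ₗ[ℂ] CStarTensor A B :=
  (TensorProduct.mk ℂ A B).compr₂ (ofAlg : Alg A B →L[ℂ] CStarTensor A B).toLinearMap

theorem tmulₗ_apply (a : A) (b : B) : tmulₗ a b = tmul a b := rfl

theorem tmul_mul_tmul (a a' : A) (b b' : B) :
    tmul a b * tmul a' b' = tmul (a * a') (b * b') := by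
  exact (ofAlg_mul (A := A) (B := B) (a ⊗ₜ[ℂ] b : A ⊗[ℂ] B) (a' ⊗ₜ[ℂ] b' : A ⊗[ℂ] B)).symm.trans
    (congrArg (ofAlg (A := A) (B := B)) (Algebra.TensorProduct.tmul_mul_tmul a a' b b'))

theorem star_tmul (a : A) (b : B) : star (tmul a b) = tmul (star a) (star b) := by
  exact (ofAlg_star (A := A) (B := B) (a ⊗ₜ[ℂ] b : A ⊗[ℂ] B)).symm

theorem norm_tmul_le (a : A) (b : B) : ‖tmul a b‖ ≤ ‖a‖ * ‖b‖ :=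
  (norm_ofAlg (A := A) (B := B) (a ⊗ₜ[ℂ] b : A ⊗[ℂ] B)).trans_le
    (ciSup_le fun p => p.2.tmul_le a b)

theorem tmul_zero_right (a : A) : tmul a (0 : B) = 0 := (tmulₗ a).map_zero

theorem tmul_zero_left (b : B) : tmul (0 : A) b = 0 := (tmulₗ.flip b).map_zero

theorem sum_tmul {ι : Type*} (s : Finset ι) (f : ι → A) (b : B) :
    tmul (∑ i ∈ s, f i) b = ∑ i ∈ s, tmul (f i) b := map_sum (tmulₗ.flip b) f s

/-- `b ↦ a ⊗ b` as a continuous linear map. -/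
def tmulCLM (a : A) : B →L[ℂ] CStarTensor A B :=
  (tmulₗ a).mkContinuous ‖a‖ (norm_tmul_le a)

end Tmul

/-- Finitely supported matrices over `A`, as elements of `A ⊗ 𝒦`. -/
def ofFinsupp : (ℕ × ℕ →₀ A) →ₗ[ℂ] CStarTensor A CompactsEllTwo :=
  Finsupp.lsum ℂ fun p => tmulₗ.flip (matrixUnit p.1 p.2)

theorem ofFinsupp_single (p : ℕ × ℕ) (a : A) :
    ofFinsupp (Finsupp.single p a) = tmul a (matrixUnit p.1 p.2) := by
  simp [ofFinsupp, tmulₗ_apply]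

theorem denseRange_ofFinsupp : DenseRange (ofFinsupp (A := A)) := by
  have h : ∀ x : CStarTensor A CompactsEllTwo,
      x ∈ (LinearMap.range (ofFinsupp (A := A))).topologicalClosure := by
    intro x
    induction x using induction_on with
    | hp => exact Submodule.isClosed_topologicalClosure _
    | h t =>
      induction t using TensorProduct.induction_on with
      | zero => exact (map_zero (ofAlg (A := A) (B := CompactsEllTwo))).symm ▸ Submodule.zero_mem _
      | add s t hs ht =>
        have : ofAlg (A := A) (B := CompactsEllTwo) (s + t) = ofAlg s + ofAlg t :=
          map_add (ofAlg (A := A) (B := CompactsEllTwo)) s t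
        exact this ▸ Submodule.add_mem _ hs ht
      | tmul a k =>
        refine mem_of_isClosed
          (Submodule.comap (tmulCLM a).toLinearMap
            (LinearMap.range (ofFinsupp (A := A))).topologicalClosure)
          ((Submodule.isClosed_topologicalClosure _).preimage (tmulCLM a).continuous) ?_ k
        intro i j
        exact Submodule.le_topologicalClosure _ ⟨Finsupp.single (i, j) a, ofFinsupp_single _ _⟩
  intro x
  have := h x
  rwa [← SetLike.mem_coe, Submodule.topologicalClosure_coe] at this

/-- The bound `n` does not depend on `f`, so `ofFinsupp v` and `rowMap g v` expand over the same
square of indices. -/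
theorem exists_sum_eq_sum_range {M : Type*} [AddCommMonoid M] (v : ℕ × ℕ →₀ A) :
    ∃ n : ℕ, ∀ f : ℕ × ℕ → A → M, (∀ p, f p 0 = 0) →
      v.sum f = ∑ i ∈ Finset.range n, ∑ j ∈ Finset.range n, f (i, j) (v (i, j)) := by
  obtain ⟨n, hn⟩ := (v.support.image Prod.fst ∪ v.support.image Prod.snd).exists_nat_subset_range
  refine ⟨n, fun f hf => ?_⟩
  rw [Finsupp.sum_of_support_subset v (s := Finset.range n ×ˢ Finset.range n) _ f
    (fun p _ => hf p), Finset.sum_product]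
  intro p hp
  rw [Finset.mem_product]
  exact ⟨hn (Finset.mem_union_left _ (Finset.mem_image_of_mem _ hp)),
    hn (Finset.mem_union_right _ (Finset.mem_image_of_mem _ hp))⟩

/-- A finite row over `A`, as an element of `A ⊗ 𝒦`. -/
def row (s : Finset ℕ) (b : ℕ → A) : CStarTensor A CompactsEllTwo :=
  ∑ j ∈ s, tmul (b j) (matrixUnit 0 j)

/-- A finite column over `A`, as an element of `A ⊗ 𝒦`. -/
def col (s : Finset ℕ) (c : ℕ → A) : CStarTensor A CompactsEllTwo :=
  ∑ i ∈ s, tmul (c i) (matrixUnit i 0)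

theorem star_row (s : Finset ℕ) (b : ℕ → A) : star (row s b) = col s fun j => star (b j) := by
  rw [row, star_sum, col]
  exact Finset.sum_congr rfl fun j _ => by rw [star_tmul, star_matrixUnit]

theorem star_col (s : Finset ℕ) (b : ℕ → A) : star (col s b) = row s fun j => star (b j) := by
  rw [col, star_sum, row]
  exact Finset.sum_congr rfl fun j _ => by rw [star_tmul, star_matrixUnit]

theorem row_mul_col (s : Finset ℕ) (b c : ℕ → A) :
    row s b * col s c = tmul (∑ j ∈ s, b j * c j) (matrixUnit 0 0) := by
  rw [row, col, Finset.sum_mul_sum, sum_tmul]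
  refine Finset.sum_congr rfl fun j hj => ?_
  rw [Finset.sum_eq_single j]
  · rw [tmul_mul_tmul, matrixUnit_mul_same]
  · intro i _ hij
    rw [tmul_mul_tmul, matrixUnit_mul, if_neg hij.symm, tmul_zero_right]
  · exact fun h => absurd hj h

theorem tmul_mul_ofFinsupp_mul_col (b : A) (v : ℕ × ℕ →₀ A) (s : Finset ℕ) (c : ℕ → A) :
    tmul b (matrixUnit 0 0) * ofFinsupp v * col s c
      = tmul (∑ j ∈ s, b * v (0, j) * c j) (matrixUnit 0 0) := by
  induction v using Finsupp.induction_linear with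
  | zero => simp [tmul_zero_left]
  | add v w hv hw =>
    rw [map_add, mul_add, add_mul, hv, hw, ← tmulₗ_apply, ← tmulₗ_apply, ← tmulₗ_apply,
      ← LinearMap.add_apply, ← map_add, ← Finset.sum_add_distrib]
    simp [mul_add, add_mul]
  | single p a =>
    obtain ⟨k, l⟩ := p
    rw [ofFinsupp_single, tmul_mul_tmul, matrixUnit_mul, col, Finset.mul_sum, sum_tmul]
    refine Finset.sum_congr rfl fun j _ => ?_
    rw [tmul_mul_tmul]
    rcases eq_or_ne 0 k with rfl | hk
    · rcases eq_or_ne l j with rfl | hl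
      · simp [matrixUnit_mul]
      · simp [matrixUnit_mul, hl, tmul_zero_right, tmul_zero_left]
    · simp [hk, tmul_zero_right, tmul_zero_left]

variable [PartialOrder A] [StarOrderedRing A]

theorem norm_le_norm_tmul_matrixUnit (a : A) (i j : ℕ) : ‖a‖ ≤ ‖tmul a (matrixUnit i j)‖ := by
  have := norm_mul_le_norm_tmul a (matrixUnit i j)
  rwa [norm_matrixUnit, mul_one] at this

theorem norm_tmul_matrixUnit_le {A : Type*} [NonUnitalCStarAlgebra A] (a : A) (i j : ℕ) :
    ‖tmul a (matrixUnit i j)‖ ≤ ‖a‖ := by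
  have := norm_tmul_le a (matrixUnit i j)
  rwa [norm_matrixUnit, mul_one] at this

/-- A row times its adjoint is a single entry in the corner `(0, 0)`. -/
theorem sq_norm_row_le {A : Type*} [NonUnitalCStarAlgebra A] (s : Finset ℕ) (b : ℕ → A) :
    ‖row s b‖ ^ 2 ≤ ‖∑ j ∈ s, b j * star (b j)‖ := by
  rw [sq, ← CStarRing.norm_self_mul_star, star_row, row_mul_col]
  exact norm_tmul_matrixUnit_le _ _ _

theorem norm_sum_le_sq_norm_col (s : Finset ℕ) (c : ℕ → A) :
    ‖∑ j ∈ s, star (c j) * c j‖ ≤ ‖col s c‖ ^ 2 := by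
  rw [sq, ← CStarRing.norm_star_mul_self, star_col, row_mul_col]
  exact norm_le_norm_tmul_matrixUnit _ _ _

/-- The quantity `σ` is the square of row `0` of the matrix. Multiplying the matrix on the left by
`σ ⊗ e₀₀`, which isolates row `0` without a unit, and on the right by the adjoint `y` of that row
gives `σ² ⊗ e₀₀`. Hence `‖σ‖² ≤ ‖σ‖ ‖v‖ ‖y‖` with `‖y‖² ≤ ‖σ‖`. -/
theorem norm_sum_row_le (v : ℕ × ℕ →₀ A) (s : Finset ℕ) :
    ‖∑ j ∈ s, v (0, j) * star (v (0, j))‖ ≤ ‖ofFinsupp v‖ ^ 2 := by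
  set σ := ∑ j ∈ s, v (0, j) * star (v (0, j)) with hσ
  set y := col s fun j => star (v (0, j)) with hy
  have hσs : star σ = σ := by simp [hσ, star_sum]
  have h1 : tmul σ (matrixUnit 0 0) * ofFinsupp v * y = tmul (σ * σ) (matrixUnit 0 0) := by
    rw [hy, tmul_mul_ofFinsupp_mul_col]
    congr 1
    conv_rhs => rw [hσ, Finset.mul_sum]
    exact Finset.sum_congr rfl fun j _ => by rw [mul_assoc]
  have h2 : ‖y‖ ^ 2 ≤ ‖σ‖ := by
    rw [hy, ← star_row, norm_star]; exact sq_norm_row_le _ _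
  have h3 : ‖σ‖ * ‖σ‖ ≤ ‖σ‖ * ‖ofFinsupp v‖ * ‖y‖ := by
    calc ‖σ‖ * ‖σ‖ = ‖σ * σ‖ := by
          rw [← CStarRing.norm_star_mul_self, hσs]
      _ ≤ _ := norm_le_norm_tmul_matrixUnit _ 0 0
      _ ≤ ‖tmul σ (matrixUnit 0 0)‖ * ‖ofFinsupp v‖ * ‖y‖ := by
          rw [← h1]; exact (norm_mul_le _ _).trans (by gcongr; exact norm_mul_le _ _)
      _ ≤ _ := by gcongr; exact norm_tmul_matrixUnit_le _ _ _
  rcases (norm_nonneg σ).eq_or_lt with h | h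
  · rw [← h]; positivity
  have h4 : ‖σ‖ ≤ ‖ofFinsupp v‖ * ‖y‖ := by
    rw [mul_assoc] at h3; exact le_of_mul_le_mul_left h3 h
  have h5 : ‖σ‖ * ‖σ‖ ≤ ‖ofFinsupp v‖ ^ 2 * ‖σ‖ := by
    calc ‖σ‖ * ‖σ‖ ≤ (‖ofFinsupp v‖ * ‖y‖) * (‖ofFinsupp v‖ * ‖y‖) := by gcongr
      _ = ‖ofFinsupp v‖ ^ 2 * ‖y‖ ^ 2 := by ring
      _ ≤ _ := by gcongr
  exact le_of_mul_le_mul_right h5 h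

/-- The bound needed to extend the entry maps by continuity; the factor `1` is the constant passed
to `LinearMap.extendOfNorm_eq`. -/
theorem norm_entry_le (v : ℕ × ℕ →₀ A) (j : ℕ) : ‖v (0, j)‖ ≤ 1 * ‖ofFinsupp v‖ := by
  have h := norm_sum_row_le v {j}
  rw [Finset.sum_singleton, CStarRing.norm_self_mul_star, ← sq] at h
  rw [one_mul]
  exact le_of_sq_le_sq h (norm_nonneg _)

/-- The entry `(0, j)` of an element of `A ⊗ 𝒦`. -/
def entry (j : ℕ) : CStarTensor A CompactsEllTwo →L[ℂ] A :=
  (Finsupp.lapply (R := ℂ) (0, j)).extendOfNorm ofFinsupp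

theorem entry_ofFinsupp (j : ℕ) (v : ℕ × ℕ →₀ A) : entry j (ofFinsupp v) = v (0, j) :=
  LinearMap.extendOfNorm_eq denseRange_ofFinsupp ⟨1, fun v => norm_entry_le v j⟩ v

theorem norm_sum_entry_le (x : CStarTensor A CompactsEllTwo) (s : Finset ℕ) :
    ‖∑ j ∈ s, entry j x * star (entry j x)‖ ≤ ‖x‖ ^ 2 := by
  refine denseRange_ofFinsupp.induction_on x ?_ fun v => ?_
  · exact isClosed_le (by fun_prop) (by fun_prop)
  · simp only [entry_ofFinsupp]; exact norm_sum_row_le v s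

theorem entry_zero_mul_tmul (x : CStarTensor A CompactsEllTwo) (a : A) (i : ℕ) :
    entry 0 (x * tmul a (matrixUnit i 0)) = entry i x * a := by
  refine denseRange_ofFinsupp.induction_on x ?_ fun v => ?_
  · exact isClosed_eq (by fun_prop) (by fun_prop)
  · rw [entry_ofFinsupp]
    induction v using Finsupp.induction_linear with
    | zero => simp
    | add v w hv hw => rw [map_add, add_mul, map_add, hv, hw, Finsupp.add_apply, add_mul]
    | single p b =>
      obtain ⟨k, l⟩ := p
      rw [ofFinsupp_single, tmul_mul_tmul, matrixUnit_mul]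
      split_ifs with h
      · have : tmul (b * a) (matrixUnit k 0) = ofFinsupp (Finsupp.single (k, 0) (b * a)) :=
          (ofFinsupp_single (k, 0) _).symm
        rw [this, entry_ofFinsupp]
        change l = i at h
        subst h
        rcases eq_or_ne k 0 with rfl | hk
        · simp
        · simp [hk]
      · change ¬ l = i at h
        rw [tmul_zero_right, map_zero]
        simp [h]

/-! ### Bounded rows of left multipliers of `A` as left multipliers of `A ⊗ 𝒦` -/

section RowMultiplier

variable {g : ℕ → A →ₗ[ℂ] A} {C : ℝ}

/-- Left multiplication of finitely supported matrices by the row `(g i)`. -/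
def rowMap (g : ℕ → A →ₗ[ℂ] A) : (ℕ × ℕ →₀ A) →ₗ[ℂ] CStarTensor A CompactsEllTwo :=
  Finsupp.lsum ℂ fun p => (tmulₗ.flip (matrixUnit 0 p.2)) ∘ₗ g p.1

theorem rowMap_single {A : Type*} [NonUnitalCStarAlgebra A] {g : ℕ → A →ₗ[ℂ] A} (p : ℕ × ℕ) (a : A) :
    rowMap g (Finsupp.single p a) = tmul (g p.1 a) (matrixUnit 0 p.2) := by
  simp [rowMap, tmulₗ_apply]

/-- Let `ρ` be the image of the matrix `v`. Since the `g i` are left multipliers, the corner entry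
of `ρ ρ*` is `∑ g i (c i)`, where `c` is the column `v ρ*`. The hypothesis on columns bounds it by
`C ‖v ρ*‖ ≤ C ‖v‖ ‖ρ‖`, and one factor `‖ρ‖` cancels. -/
theorem norm_rowMap_le (hg : ∀ i a b, g i (a * b) = g i a * b) (hC : 0 ≤ C)
    (hgC : ∀ (s : Finset ℕ) (c : ℕ → A),
      ‖∑ i ∈ s, g i (c i)‖ ^ 2 ≤ C ^ 2 * ‖∑ i ∈ s, star (c i) * c i‖) (v : ℕ × ℕ →₀ A) :
    ‖rowMap g v‖ ≤ C * ‖ofFinsupp v‖ := by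
  obtain ⟨n, hn⟩ := exists_sum_eq_sum_range (M := CStarTensor A CompactsEllTwo) v
  set s := Finset.range n
  set b : ℕ → A := fun j => ∑ i ∈ s, g i (v (i, j)) with hb
  set c : ℕ → A := fun i => ∑ j ∈ s, v (i, j) * star (b j) with hc
  have e1 : rowMap g v = row s b := by
    rw [rowMap, Finsupp.lsum_apply, hn _ (fun p => map_zero _), Finset.sum_comm, row]
    exact Finset.sum_congr rfl fun j _ => by rw [hb, sum_tmul]; rfl
  have e2 : ofFinsupp v * star (row s b) = col s c := by
    rw [ofFinsupp, Finsupp.lsum_apply, hn _ (fun p => map_zero _), star_row, col, col,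
      Finset.sum_mul]
    refine Finset.sum_congr rfl fun i _ => ?_
    rw [hc, sum_tmul, Finset.sum_mul]
    refine Finset.sum_congr rfl fun j hj => ?_
    rw [Finset.mul_sum, Finset.sum_eq_single j]
    · change tmul (v (i, j)) (matrixUnit i j) * _ = _
      rw [tmul_mul_tmul, matrixUnit_mul_same]
    · intro k _ hk
      change tmul (v (i, j)) (matrixUnit i j) * _ = _
      rw [tmul_mul_tmul, matrixUnit_mul, if_neg hk.symm, tmul_zero_right]
    · exact fun h => absurd hj h
  have e3 : ∑ i ∈ s, g i (c i) = ∑ j ∈ s, b j * star (b j) := by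
    simp only [hc, map_sum, hg]
    rw [Finset.sum_comm]
    exact Finset.sum_congr rfl fun j _ => by rw [← Finset.sum_mul]
  rw [e1]
  set ρ := row s b
  have h1 : ‖ρ‖ ^ 2 ≤ ‖∑ i ∈ s, g i (c i)‖ := by rw [e3]; exact sq_norm_row_le _ _
  have h2 : (‖ρ‖ ^ 2) ^ 2 ≤ (C * (‖ofFinsupp v‖ * ‖ρ‖)) ^ 2 := by
    calc (‖ρ‖ ^ 2) ^ 2 ≤ ‖∑ i ∈ s, g i (c i)‖ ^ 2 := by gcongr
      _ ≤ C ^ 2 * ‖∑ i ∈ s, star (c i) * c i‖ := hgC _ _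
      _ ≤ C ^ 2 * ‖col s c‖ ^ 2 := by gcongr; exact norm_sum_le_sq_norm_col _ _
      _ ≤ C ^ 2 * (‖ofFinsupp v‖ * ‖ρ‖) ^ 2 := by
        gcongr
        rw [← e2]
        exact (norm_mul_le _ _).trans_eq (by rw [norm_star])
      _ = _ := by ring
  have h3 := le_of_sq_le_sq h2 (by positivity)
  rcases (norm_nonneg ρ).eq_or_lt with h | h
  · rw [← h]; positivity
  · refine le_of_mul_le_mul_right ?_ h
    calc ‖ρ‖ * ‖ρ‖ = ‖ρ‖ ^ 2 := (sq _).symm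
      _ ≤ _ := h3
      _ = _ := by ring

/-- If every left multiplier of `A ⊗ 𝒦` is a multiplier, then the bounded rows of left multipliers
of `A` are, after multiplication by an element of `A`, rows over `A` with convergent square sum. -/
theorem exists_row_of_leftMultipliers_eq
    (hA : leftMultipliers (CStarTensor A CompactsEllTwo) =
      multipliers (CStarTensor A CompactsEllTwo))
    (hg : ∀ i a b, g i (a * b) = g i a * b) (hC : 0 ≤ C)
    (hgC : ∀ (s : Finset ℕ) (c : ℕ → A),
      ‖∑ i ∈ s, g i (c i)‖ ^ 2 ≤ C ^ 2 * ‖∑ i ∈ s, star (c i) * c i‖) (a' : A) :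
    ∃ r : ℕ → A, (∀ i a, r i * a = a' * g i a) ∧
      ∀ ε > 0, ∃ s : Finset ℕ, ∀ t : Finset ℕ, Disjoint t s →
        ‖∑ i ∈ t, r i * star (r i)‖ < ε := by
  have hbd := norm_rowMap_le hg hC hgC
  set L := (rowMap g).extendOfNorm ofFinsupp with hL
  have hLv : ∀ v, L (ofFinsupp v) = rowMap g v := fun v =>
    LinearMap.extendOfNorm_eq denseRange_ofFinsupp ⟨C, hbd⟩ v
  have hLmem : L ∈ leftMultipliers (CStarTensor A CompactsEllTwo) := by
    intro x y
    refine denseRange_ofFinsupp.induction_on₂ (p := fun x y => L (x * y) = L x * y) ?_ ?_ x y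
    · exact isClosed_eq (by fun_prop) (by fun_prop)
    · intro v w
      induction v using Finsupp.induction_linear with
      | zero => simp
      | add v v' hv hv' => rw [map_add, add_mul, map_add, hv, hv', map_add, add_mul]
      | single p a =>
        induction w using Finsupp.induction_linear with
        | zero => simp
        | add w w' hw hw' => rw [map_add, mul_add, map_add, hw, hw', mul_add]
        | single q b =>
          obtain ⟨i, j⟩ := p
          obtain ⟨k, l⟩ := q
          rw [hLv, rowMap_single, ofFinsupp_single, ofFinsupp_single, tmul_mul_tmul,
            tmul_mul_tmul, matrixUnit_mul, matrixUnit_mul]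
          dsimp only
          split_ifs with h
          · have : tmul (a * b) (matrixUnit i l) = ofFinsupp (Finsupp.single (i, l) (a * b)) :=
              (ofFinsupp_single (i, l) _).symm
            rw [this, hLv, rowMap_single, hg]
          · rw [tmul_zero_right, tmul_zero_right, map_zero]
  rw [hA] at hLmem
  obtain ⟨m, hm⟩ := hLmem
  -- The hypothesis `hA` enters here: the right action of the double centralizer makes the product
  -- of `a' ⊗ e₀₀` with the row an element of `A ⊗ 𝒦`.
  set ρ := m.snd (tmul a' (matrixUnit 0 0))
  have hρ : ∀ i a, ρ * tmul a (matrixUnit i 0) = tmul (a' * g i a) (matrixUnit 0 0) := by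
    intro i a
    have h1 : L (tmul a (matrixUnit i 0)) = tmul (g i a) (matrixUnit 0 0) := by
      have : tmul a (matrixUnit i 0) = ofFinsupp (Finsupp.single (i, 0) a) :=
        (ofFinsupp_single (i, 0) _).symm
      rw [this, hLv, rowMap_single]
    have h2 := m.central (tmul a' (matrixUnit 0 0)) (tmul a (matrixUnit i 0))
    have h3 : m.fst = L := hm
    rw [h3, h1, tmul_mul_tmul, matrixUnit_mul_same] at h2
    exact h2
  refine ⟨fun i => entry i ρ, fun i a => ?_, fun ε hε => ?_⟩
  · rw [← entry_zero_mul_tmul, hρ]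
    have : tmul (a' * g i a) (matrixUnit 0 0)
        = ofFinsupp (Finsupp.single (0, 0) (a' * g i a)) := (ofFinsupp_single (0, 0) _).symm
    rw [this, entry_ofFinsupp, Finsupp.single_eq_same]
  -- A finitely supported `v` within `√ε` of `ρ` has no entries in the columns outside its support,
  -- so there the entries of `ρ` are those of `ρ - v`.
  · obtain ⟨v, hv⟩ := denseRange_ofFinsupp.exists_dist_lt ρ (Real.sqrt_pos.2 hε)
    rw [dist_eq_norm] at hv
    refine ⟨v.support.image Prod.snd, fun t ht => ?_⟩
    have h1 : ∀ i ∈ t, entry i ρ = entry i (ρ - ofFinsupp v) := by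
      intro i hi
      rw [map_sub, entry_ofFinsupp]
      have : v (0, i) = 0 := by
        by_contra h
        exact Finset.disjoint_left.1 ht hi
          (Finset.mem_image.2 ⟨(0, i), Finsupp.mem_support_iff.2 h, rfl⟩)
      rw [this, sub_zero]
    have h2 : ∑ i ∈ t, entry i ρ * star (entry i ρ)
        = ∑ i ∈ t, entry i (ρ - ofFinsupp v) * star (entry i (ρ - ofFinsupp v)) :=
      Finset.sum_congr rfl fun i hi => by rw [h1 i hi]
    change ‖∑ i ∈ t, entry i ρ * star (entry i ρ)‖ < ε
    rw [h2]
    refine (norm_sum_entry_le _ t).trans_lt ?_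
    calc _ < √ε ^ 2 := by gcongr
      _ = ε := Real.sq_sqrt hε.le

end RowMultiplier

end

end CStarTensor

/-! ### Symmetric and positive operators on Hilbert modules -/

namespace CStarModule

open Polynomial

section

variable (D : Type*) {E : Type*} [NonUnitalCStarAlgebra D] [PartialOrder D] [StarOrderedRing D]
  [NormedAddCommGroup E] [NormedSpace ℂ E] [SMul D E] [CStarModule D E]

/-- A bounded operator on a Hilbert module is symmetric if it is its own adjoint. -/
def IsSymm (T : E →L[ℂ] E) : Prop := ∀ x y : E, inner D (T x) y = inner D x (T y)

/-- Symmetric operators with nonnegative quadratic form. -/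
structure IsPos (T : E →L[ℂ] E) : Prop where
  symm : IsSymm D T
  nonneg : ∀ x : E, 0 ≤ inner D x (T x)

variable {D} {S T : E →L[ℂ] E}

include D in
variable (D) in
theorem ext_inner {x y : E} (h : ∀ z : E, inner D z x = inner D z y) : x = y := by
  rw [← sub_eq_zero, ← inner_self (A := D), inner_sub_right, h, sub_self]

theorem norm_op_smul_le (d : D) (x : E) : ‖d • x‖ ≤ ‖d‖ * ‖x‖ := by
  refine le_of_sq_le_sq ?_ (by positivity)
  rw [norm_sq_eq D, inner_op_smul_left, inner_op_smul_right, mul_pow, norm_sq_eq D (x := x)]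
  calc _ ≤ ‖d‖ * ‖inner D x x‖ * ‖star d‖ :=
        (norm_mul_le _ _).trans (by gcongr; exact norm_mul_le _ _)
    _ = _ := by rw [norm_star]; ring

theorem op_smul_add (d : D) (x y : E) : d • (x + y) = d • x + d • y :=
  ext_inner D fun z => by simp [mul_add]

theorem add_op_smul (d d' : D) (x : E) : (d + d') • x = d • x + d' • x :=
  ext_inner D fun z => by simp [add_mul]

theorem op_smul_smul (c : ℂ) (d : D) (x : E) : d • c • x = c • d • x :=
  ext_inner D fun z => by simp [mul_smul_comm]

theorem smul_op_smul (c : ℂ) (d : D) (x : E) : (c • d) • x = c • d • x :=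
  ext_inner D fun z => by simp [smul_mul_assoc]

theorem mul_op_smul (d d' : D) (x : E) : (d * d') • x = d • d' • x :=
  ext_inner D fun z => by simp [mul_assoc]

/-- The action of an element of the algebra on a Hilbert module. -/
def opSMulCLM (d : D) : E →L[ℂ] E :=
  LinearMap.mkContinuous ⟨⟨fun x => d • x, op_smul_add d⟩, fun c x => op_smul_smul c d x⟩ ‖d‖
    (norm_op_smul_le d)

/-- The orbit map `d ↦ d • x`. -/
def orbitCLM (x : E) : D →L[ℂ] E :=
  LinearMap.mkContinuous ⟨⟨fun d => d • x, fun d d' => add_op_smul d d' x⟩,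
    fun c d => smul_op_smul c d x⟩ ‖x‖ fun d => (norm_op_smul_le d x).trans_eq (mul_comm _ _)

include D in
variable (D) in
-- With `a = ⟪x, x⟫`, the square of `‖d • x - x‖` is the norm of `a - d a - (a d* - d a d*)`, which
-- tends to `0` along an approximate unit.
theorem mem_closure_range_op_smul (x : E) : x ∈ closure (Set.range fun d : D => d • x) := by
  set a := inner D x x
  have hl := CStarAlgebra.increasingApproximateUnit D
  have h1 : Filter.Tendsto (fun d : D => a - d * a - (a * star d - d * a * star d))
      (CStarAlgebra.approximateUnit D) (nhds 0) := by
    have ht := hl.tendsto_mul_right a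
    have hb : ∀ᶠ d in CStarAlgebra.approximateUnit D, ‖d‖ ≤ 1 := hl.eventually_norm
    rw [tendsto_zero_iff_norm_tendsto_zero]
    have h2 : Filter.Tendsto (fun d : D => 2 * ‖a - d * a‖) (CStarAlgebra.approximateUnit D)
        (nhds 0) := by
      have := ((tendsto_const_nhds (x := a)).sub ht).norm.const_mul 2
      simpa using this
    refine squeeze_zero' (Filter.Eventually.of_forall fun _ => norm_nonneg _) ?_ h2
    filter_upwards [hb] with d hd
    have : a - d * a - (a * star d - d * a * star d) = (a - d * a) - (a - d * a) * star d := by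
      rw [sub_mul]
    rw [this, two_mul]
    refine (norm_sub_le _ _).trans (by gcongr; refine (norm_mul_le _ _).trans ?_; rw [norm_star]; exact mul_le_of_le_one_right (norm_nonneg _) hd)
  have h2 : Filter.Tendsto (fun d : D => d • x) (CStarAlgebra.approximateUnit D) (nhds x) := by
    rw [tendsto_iff_norm_sub_tendsto_zero]
    have h3 : ∀ d : D, ‖d • x - x‖ = √‖a - d * a - (a * star d - d * a * star d)‖ := by
      intro d
      rw [norm_sub_rev, norm_eq_sqrt_norm_inner_self (A := D)]
      simp only [inner_sub_left, inner_sub_right, inner_op_smul_left, inner_op_smul_right]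
      congr 2
      simp only [a, mul_assoc, mul_sub]
      abel
    simp_rw [h3]
    have := (Real.continuous_sqrt.tendsto _).comp h1.norm
    simpa [Function.comp_def] using this
  exact mem_closure_of_tendsto h2 (Filter.Eventually.of_forall fun d => ⟨d, rfl⟩)

theorem IsSymm.map_op_smul (hT : IsSymm D T) (d : D) (x : E) : T (d • x) = d • T x :=
  ext_inner D fun z => by rw [← hT, inner_op_smul_right, inner_op_smul_right, hT]

theorem IsSymm.one : IsSymm D (1 : E →L[ℂ] E) := fun _ _ => rfl

theorem IsSymm.add (hS : IsSymm D S) (hT : IsSymm D T) : IsSymm D (S + T) := fun x y => by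
  simp [hS x y, hT x y]

theorem IsSymm.sub (hS : IsSymm D S) (hT : IsSymm D T) : IsSymm D (S - T) := fun x y => by
  simp [hS x y, hT x y]

theorem IsSymm.pow (hS : IsSymm D S) (n : ℕ) : IsSymm D (S ^ n) := by
  induction n with
  | zero => exact IsSymm.one
  | succ n ih =>
    intro x y
    rw [pow_succ, mul_apply_eq_comp, ih, hS, ← mul_apply_eq_comp,
      ← pow_succ', pow_succ]

theorem IsSymm.zsmul (hS : IsSymm D S) (n : ℤ) : IsSymm D (n • S) := by
  induction n using Int.induction_on with
  | zero => intro x y; simp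
  | succ n ih => rw [add_smul, one_smul]; exact ih.add hS
  | pred n ih => rw [sub_smul, one_smul]; exact ih.sub hS

theorem IsSymm.aeval (hS : IsSymm D S) (p : ℤ[X]) : IsSymm D (aeval S p) := by
  induction p using Polynomial.induction_on' with
  | add p q hp hq => rw [map_add]; exact hp.add hq
  | monomial n a =>
    rw [aeval_monomial, Algebra.algebraMap_eq_smul_one, smul_mul_assoc, one_mul]
    exact (hS.pow n).zsmul a

theorem IsPos.one : IsPos D (1 : E →L[ℂ] E) := ⟨IsSymm.one, fun _ => inner_self_nonneg⟩

theorem IsPos.add (hS : IsPos D S) (hT : IsPos D T) : IsPos D (S + T) :=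
  ⟨hS.symm.add hT.symm, fun x => by simpa using add_nonneg (hS.nonneg x) (hT.nonneg x)⟩

theorem IsPos.nsmul (hS : IsPos D S) (n : ℕ) : IsPos D (n • S) := by
  induction n with
  | zero => exact ⟨fun x y => by simp, fun x => by simp⟩
  | succ n ih => rw [succ_nsmul]; exact ih.add hS

theorem IsPos.conj (hS : IsSymm D S) (hT : IsPos D T) : IsPos D (S * T * S) :=
  ⟨fun x y => by
    simp only [mul_apply_eq_comp]; rw [hS, hT.symm, hS], fun x => by
    simp only [mul_apply_eq_comp]; rw [← hS]; exact hT.nonneg _⟩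

/-- A symmetric contraction is bounded by the identity in the order sense. -/
theorem IsSymm.inner_apply_le (hT : IsSymm D T) (h1 : ‖T‖ ≤ 1) (x : E) :
    inner D x (T x) ≤ inner D x x := by
  -- Positivity of `(1 - T)²` says `1 - T ≥ (1 - T²) / 2`. Iterating with `T²` gives `1 - T ≥ (1 -
  -- T^(2^k)) / 2^k`, whose right side tends to `0` for a contraction.
  have key : ∀ k : ℕ, ∀ T : E →L[ℂ] E, IsSymm D T →
      ((1 / 2 : ℝ) ^ k) • (inner D x x - inner D x ((T ^ 2 ^ k) x))
        ≤ inner D x x - inner D x (T x) := by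
    intro k
    induction k with
    | zero => intro T _; simp
    | succ k ih =>
      intro T hT
      have h2 := ih (T ^ 2) (hT.pow 2)
      have h3 : (1 / 2 : ℝ) • (inner D x x - inner D x ((T ^ 2) x))
          ≤ inner D x x - inner D x (T x) := by
        have h4 : (0 : D) ≤ (1 / 2 : ℝ) • inner D (x - T x) (x - T x) :=
          smul_nonneg (by norm_num) inner_self_nonneg
        rw [← sub_nonneg]
        convert h4 using 1
        have h5 : inner D (T x) (T x) = inner D x ((T ^ 2) x) := by
          rw [hT, pow_two, mul_apply_eq_comp]
        rw [inner_sub_left, inner_sub_right, inner_sub_right, h5, hT x x]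
        module
      rw [← pow_mul, ← pow_succ'] at h2
      refine le_trans ?_ h3
      rw [pow_succ', mul_smul]
      exact smul_le_smul_of_nonneg_left h2 (by norm_num)
  rw [← sub_nonneg]
  refine le_of_tendsto' (x := Filter.atTop) ?_ fun k => key k T hT
  rw [tendsto_zero_iff_norm_tendsto_zero]
  have h6 : Filter.Tendsto (fun k : ℕ => (1 / 2 : ℝ) ^ k * (2 * ‖x‖ ^ 2)) Filter.atTop (nhds 0) := by
    simpa using (tendsto_pow_atTop_nhds_zero_of_lt_one (r := (1 / 2 : ℝ)) (by norm_num)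
      (by norm_num)).mul_const (2 * ‖x‖ ^ 2)
  refine squeeze_zero (fun _ => norm_nonneg _) (fun k => ?_) h6
  rw [norm_smul, Real.norm_of_nonneg (by positivity)]
  gcongr
  rw [two_mul]
  refine (norm_sub_le _ _).trans ?_
  rw [← norm_sq_eq D]
  gcongr
  refine (norm_inner_le E).trans ?_
  rw [sq]
  gcongr
  refine ((T ^ 2 ^ k).le_opNorm x).trans ?_
  refine mul_le_of_le_one_left (norm_nonneg _) ?_
  exact (norm_pow_le' T (by positivity)).trans (pow_le_one₀ (norm_nonneg _) h1)

theorem IsSymm.isPos_one_sub (hT : IsSymm D T) (h1 : ‖T‖ ≤ 1) : IsPos D (1 - T) :=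
  ⟨IsSymm.one.sub hT, fun x => by simpa using hT.inner_apply_le h1 x⟩

end

/-! ### The iteration `r ↦ r - r θ r` for a positive contraction `θ` -/

/-- The polynomials of the iteration `r ↦ r - r θ r` started at `1`. -/
def iterPoly : ℕ → ℤ[X]
  | 0 => 1
  | n + 1 => iterPoly n - iterPoly n * X * iterPoly n

theorem sum_iterPoly (M : ℕ) :
    ∑ m ∈ Finset.range M, iterPoly m * X * iterPoly m = 1 - iterPoly M := by
  induction M with
  | zero => simp [iterPoly]
  | succ M ih => rw [Finset.sum_range_succ, ih, iterPoly]; ring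

theorem X_dvd_one_sub_iterPoly (M : ℕ) : X ∣ 1 - iterPoly M := by
  rw [← sum_iterPoly]
  exact Finset.dvd_sum fun m _ => ⟨iterPoly m * iterPoly m, by ring⟩

section

variable {D E : Type*} [NonUnitalCStarAlgebra D] [PartialOrder D] [StarOrderedRing D]
  [NormedAddCommGroup E] [NormedSpace ℂ E] [SMul D E] [CStarModule D E] {θ : E →L[ℂ] E}

theorem IsPos.aeval_conj (hθ : IsSymm D θ) {p : ℤ[X]} (hp : IsPos D (aeval θ p)) (q : ℤ[X]) :
    IsPos D (aeval θ (q * p * q)) := by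
  rw [map_mul, map_mul]; exact IsPos.conj (hθ.aeval q) hp

theorem IsPos.aeval_add {p q : ℤ[X]} (hp : IsPos D (aeval θ p)) (hq : IsPos D (aeval θ q)) :
    IsPos D (aeval θ (p + q)) := by
  rw [map_add]; exact hp.add hq

theorem IsPos.aeval_X (hθ : IsPos D θ) : IsPos D (aeval θ (X : ℤ[X])) := by rwa [Polynomial.aeval_X]

theorem IsPos.aeval_one_sub_X (hθ : IsPos D θ) (h1 : ‖θ‖ ≤ 1) :
    IsPos D (aeval θ (1 - X : ℤ[X])) := by
  simpa using hθ.symm.isPos_one_sub h1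

theorem IsPos.aeval_mul_one_sub (hθ : IsSymm D θ) {p : ℤ[X]} (hp : IsPos D (aeval θ p))
    (hp' : IsPos D (aeval θ (1 - p))) : IsPos D (aeval θ (p * (1 - p))) := by
  have h : p * (1 - p) = (1 - p) * p * (1 - p) + p * (1 - p) * p := by ring
  rw [h]
  exact (hp.aeval_conj hθ _).aeval_add (hp'.aeval_conj hθ _)

/-- The quantitative claim is `M r_M θ r_M ≤ 1 - r_M`, alongside `0 ≤ r_M ≤ 1`. Each polynomial is
written as a sum of conjugates `q p q` of positive ones, so neither square roots nor a functional
calculus are needed. -/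
theorem isPos_iterPoly (hθ : IsPos D θ) (h1 : ‖θ‖ ≤ 1) (M : ℕ) :
    IsPos D (aeval θ (iterPoly M)) ∧ IsPos D (aeval θ (1 - iterPoly M)) ∧
      IsPos D (aeval θ (1 - iterPoly M - M • (iterPoly M * X * iterPoly M))) := by
  have hs := hθ.symm
  have hX := hθ.aeval_X
  have hX1 := hθ.aeval_one_sub_X h1
  induction M with
  | zero =>
    refine ⟨by simpa [iterPoly] using IsPos.one, ?_, ?_⟩ <;>
    · simp only [iterPoly, sub_self, zero_smul, map_zero]
      exact ⟨fun x y => by simp, fun x => by simp⟩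
  | succ M ih =>
    obtain ⟨hp, hp1, hpM⟩ := ih
    set p := iterPoly M
    have e : iterPoly (M + 1) = p - p * X * p := rfl
    have h3 : IsPos D (aeval θ (p - p * X * p)) := by
      have h : p - p * X * p = (1 - p * X) * p * (1 - p * X)
          + p * (X * (1 - X) + X * (1 - p) * X) * p := by ring
      rw [h]
      exact (hp.aeval_conj hs _).aeval_add
        (((hX.aeval_mul_one_sub hs hX1).aeval_add (hp1.aeval_conj hs X)).aeval_conj hs p)
    refine ⟨e ▸ h3, ?_, ?_⟩
    · have h : 1 - iterPoly (M + 1) = (1 - p) + p * X * p := by rw [e]; ring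
      rw [h]
      exact hp1.aeval_add (hX.aeval_conj hs p)
    · have h : 1 - iterPoly (M + 1) - (M + 1) • (iterPoly (M + 1) * X * iterPoly (M + 1))
          = (1 - p - M • (p * X * p))
            + (M + 1) • ((p * X) * (p + (p - p * X * p)) * (p * X)) := by
        rw [e]; simp only [nsmul_eq_mul]; push_cast; ring
      rw [h, map_add, map_nsmul]
      exact hpM.add (((hp.aeval_add h3).aeval_conj hs _).nsmul _)

theorem norm_aeval_iterPoly_le (hθ : IsPos D θ) (h1 : ‖θ‖ ≤ 1) (M : ℕ) (x : E) :
    ‖aeval θ (iterPoly M) x‖ ≤ ‖x‖ := by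
  obtain ⟨hp, hp1, -⟩ := isPos_iterPoly hθ h1 M
  set p := iterPoly M
  have h : IsPos D (aeval θ (1 - p * p)) := by
    have h : 1 - p * p = (1 - p) + p * (1 - p) := by ring
    rw [h]
    exact hp1.aeval_add (hp.aeval_mul_one_sub hθ.symm hp1)
  have h2 := h.nonneg x
  rw [map_sub, map_one, map_mul, sub_apply, mul_apply_eq_comp,
    inner_sub_right, ← hθ.symm.aeval p, sub_nonneg] at h2
  have h3 := CStarAlgebra.norm_le_norm_of_nonneg_of_le inner_self_nonneg h2
  rw [← norm_sq_eq, one_apply_eq_self, ← norm_sq_eq] at h3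
  exact le_of_sq_le_sq h3 (norm_nonneg _)

theorem nsmul_inner_iterPoly_le (hθ : IsPos D θ) (h1 : ‖θ‖ ≤ 1) (M : ℕ) (x : E) :
    M • inner D (aeval θ (iterPoly M) x) (θ (aeval θ (iterPoly M) x)) ≤ inner D x x := by
  obtain ⟨hp, -, hpM⟩ := isPos_iterPoly hθ h1 M
  set p := iterPoly M
  have h2 := (hp.add hpM).nonneg x
  have h3 : p + (1 - p - M • (p * X * p)) = 1 - M • (p * X * p) := by ring
  rw [← map_add, h3, map_sub, map_one, map_nsmul, map_mul, map_mul, Polynomial.aeval_X,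
    sub_apply, inner_sub_right, sub_nonneg] at h2
  rw [one_apply_eq_self] at h2
  convert h2 using 1
  rw [← Nat.cast_smul_eq_nsmul ℂ, ← Nat.cast_smul_eq_nsmul ℂ, smul_apply,
    inner_smul_right_complex, mul_apply_eq_comp, mul_apply_eq_comp,
    hθ.symm.aeval p]

/-- Follows from `M r_M θ r_M ≤ 1`, because `θ² ≤ θ` for a positive contraction. -/
theorem mul_sq_norm_iterPoly_le (hθ : IsPos D θ) (h1 : ‖θ‖ ≤ 1) (M : ℕ) (x : E) :
    M * ‖θ (aeval θ (iterPoly M) x)‖ ^ 2 ≤ ‖x‖ ^ 2 := by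
  set y := aeval θ (iterPoly M) x with hy
  have h2 : inner D (θ y) (θ y) ≤ inner D y (θ y) := by
    have h := ((hθ.aeval_X.aeval_mul_one_sub hθ.symm (hθ.aeval_one_sub_X h1))).nonneg y
    rw [mul_one_sub, map_sub, map_mul, Polynomial.aeval_X, sub_apply,
      mul_apply_eq_comp, inner_sub_right, sub_nonneg] at h
    rwa [hθ.symm]
  have h3 : M • inner D (θ y) (θ y) ≤ inner D x x :=
    (nsmul_le_nsmul_right h2 M).trans (nsmul_inner_iterPoly_le hθ h1 M x)
  have h4 := CStarAlgebra.norm_le_norm_of_nonneg_of_le (nsmul_nonneg inner_self_nonneg M) h3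
  rw [← norm_sq_eq D, ← Nat.cast_smul_eq_nsmul ℝ, norm_smul, ← norm_sq_eq D,
    Real.norm_of_nonneg (Nat.cast_nonneg M)] at h4
  exact h4

end

end CStarModule

/-! ### Bessel sequences, frame operators and countable frames -/

namespace CStarModule

open Polynomial

section

open CStarTensor CompactsEllTwo in
/-- A finite Cauchy–Schwarz inequality in a C⋆-algebra. -/
theorem sq_norm_sum_mul_le {D : Type*} [NonUnitalCStarAlgebra D] [PartialOrder D]
    [StarOrderedRing D] (s : Finset ℕ) (a b : ℕ → D) :
    ‖∑ i ∈ s, a i * b i‖ ^ 2 ≤ ‖∑ i ∈ s, a i * star (a i)‖ * ‖∑ i ∈ s, star (b i) * b i‖ := by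
  have h1 : ‖∑ i ∈ s, a i * b i‖ ≤ ‖row s a‖ * ‖col s b‖ := by
    refine (norm_le_norm_tmul_matrixUnit _ 0 0).trans ?_
    rw [← row_mul_col]
    exact norm_mul_le _ _
  have h2 : ‖col s b‖ ^ 2 ≤ ‖∑ i ∈ s, star (b i) * b i‖ := by
    rw [← norm_star, star_col]
    simpa using sq_norm_row_le s fun i => star (b i)
  calc _ ≤ (‖row s a‖ * ‖col s b‖) ^ 2 := by gcongr
    _ = ‖row s a‖ ^ 2 * ‖col s b‖ ^ 2 := mul_pow _ _ _
    _ ≤ _ := by gcongr; exact sq_norm_row_le s a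

variable (D : Type*) {E : Type*} [NonUnitalCStarAlgebra D] [PartialOrder D] [StarOrderedRing D]
  [NormedAddCommGroup E] [NormedSpace ℂ E] [SMul D E] [CStarModule D E]

variable {D} in
/-- The synthesis operator of a Bessel sequence is contractive. -/
theorem sq_norm_sum_op_smul_le (y : ℕ → E) (s : Finset ℕ)
    (hy : ∀ z, ∑ k ∈ s, inner D (y k) z * inner D z (y k) ≤ inner D z z) (d : ℕ → D) :
    ‖∑ k ∈ s, d k • y k‖ ^ 2 ≤ ‖∑ k ∈ s, d k * star (d k)‖ := by
  set z := ∑ k ∈ s, d k • y k with hz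
  -- Expanding one copy of `z` prepares the Cauchy–Schwarz inequality, whose second factor is
  -- bounded by the Bessel inequality at `z` itself; one `‖z‖²` then cancels.
  have h1 : inner D z z = ∑ k ∈ s, d k * inner D z (y k) := by
    conv_lhs => rw [hz, inner_sum_right, ← hz]
    simp
  have h2 := sq_norm_sum_mul_le s d fun k => inner D z (y k)
  rw [← h1, ← norm_sq_eq D] at h2
  have h3 : ‖∑ k ∈ s, star (inner D z (y k)) * inner D z (y k)‖ ≤ ‖z‖ ^ 2 := by
    rw [norm_sq_eq D]
    simp only [star_inner]
    refine CStarAlgebra.norm_le_norm_of_nonneg_of_le (Finset.sum_nonneg fun k _ => ?_) (hy z)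
    rw [← star_inner]
    exact star_mul_self_nonneg _
  rcases (norm_nonneg z).eq_or_lt with h | h
  · rw [← h, zero_pow two_ne_zero]; exact norm_nonneg _
  · have h4 : ‖z‖ ^ 2 * ‖z‖ ^ 2 ≤ ‖∑ k ∈ s, d k * star (d k)‖ * ‖z‖ ^ 2 := by
      rw [← sq]
      exact h2.trans (by gcongr)
    exact le_of_mul_le_mul_right h4 (by positivity)

/-- The operator `z ↦ ⟪u, z⟫ • u`. -/
def rankOneSelf (u : E) : E →L[ℂ] E := orbitCLM u ∘L (innerSL u : E →L[ℂ] D)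

theorem rankOneSelf_apply (u z : E) : rankOneSelf D u z = inner D u z • u := rfl

theorem norm_rankOneSelf_le (u : E) : ‖rankOneSelf D u‖ ≤ ‖u‖ ^ 2 := by
  refine ContinuousLinearMap.opNorm_le_bound _ (by positivity) fun z => ?_
  rw [rankOneSelf_apply]
  refine (norm_op_smul_le _ _).trans ?_
  calc _ ≤ (‖u‖ * ‖z‖) * ‖u‖ := by gcongr; exact norm_inner_le E
    _ = _ := by ring

theorem isSymm_rankOneSelf (u : E) : IsSymm D (rankOneSelf D u) := fun x y => by
  rw [rankOneSelf_apply, rankOneSelf_apply, inner_op_smul_left, inner_op_smul_right, star_inner]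

variable [CompleteSpace E] {x : ℕ → E}

/-- The frame operator `z ↦ ∑ ⟪xₙ, z⟫ • xₙ` of a square summable sequence. -/
def frameOp (x : ℕ → E) : E →L[ℂ] E := ∑' n, rankOneSelf D (x n)

theorem summable_rankOneSelf (hx : Summable fun n => ‖x n‖ ^ 2) :
    Summable fun n => rankOneSelf D (x n) :=
  Summable.of_norm_bounded hx fun n => norm_rankOneSelf_le D (x n)

theorem hasSum_frameOp_apply (hx : Summable fun n => ‖x n‖ ^ 2) (z : E) :
    HasSum (fun n => inner D (x n) z • x n) (frameOp D x z) :=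
  (summable_rankOneSelf D hx).hasSum.mapL (ContinuousLinearMap.apply ℂ E z)

theorem norm_frameOp_le (hx : Summable fun n => ‖x n‖ ^ 2) (h1 : ∑' n, ‖x n‖ ^ 2 ≤ 1) :
    ‖frameOp D x‖ ≤ 1 :=
  (tsum_of_norm_bounded hx.hasSum fun n => norm_rankOneSelf_le D (x n)).trans h1

theorem isSymm_frameOp (hx : Summable fun n => ‖x n‖ ^ 2) : IsSymm D (frameOp D x) := by
  intro y z
  have h1 := (hasSum_frameOp_apply D hx z).mapL (innerSL y : E →L[ℂ] D)
  have h2 := (hasSum_frameOp_apply D hx y).mapL (innerSL z : E →L[ℂ] D)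
  have h3 := h2.star
  simp only [innerSL_apply, star_inner] at h1 h3
  refine h3.unique ?_
  convert h1 using 2 with n
  exact isSymm_rankOneSelf D (x n) y z

theorem hasSum_inner_frameOp (hx : Summable fun n => ‖x n‖ ^ 2) (z : E) :
    HasSum (fun n => inner D (x n) z * inner D z (x n)) (inner D z (frameOp D x z)) := by
  have h1 := (hasSum_frameOp_apply D hx z).mapL (innerSL z : E →L[ℂ] D)
  simpa only [innerSL_apply, inner_op_smul_right] using h1

variable {D} in
theorem inner_mul_inner_nonneg (u z : E) : 0 ≤ inner D u z * inner D z u := by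
  rw [← star_inner z u]; exact star_mul_self_nonneg _

theorem sum_inner_le_inner_frameOp (hx : Summable fun n => ‖x n‖ ^ 2) (s : Finset ℕ) (z : E) :
    ∑ n ∈ s, inner D (x n) z * inner D z (x n) ≤ inner D z (frameOp D x z) :=
  sum_le_hasSum s (fun _ _ => inner_mul_inner_nonneg _ _) (hasSum_inner_frameOp D hx z)

theorem isPos_frameOp (hx : Summable fun n => ‖x n‖ ^ 2) : IsPos D (frameOp D x) :=
  ⟨isSymm_frameOp D hx, fun z => by simpa using sum_inner_le_inner_frameOp D hx ∅ z⟩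

/-- The closed submodule generated by a sequence. -/
def closedSpan (x : ℕ → E) : Submodule ℂ E :=
  (Submodule.span ℂ {y : E | ∃ n, ∃ d : D, y = d • x n}).topologicalClosure

theorem isClosed_closedSpan : IsClosed (closedSpan D x : Set E) :=
  Submodule.isClosed_topologicalClosure _

variable {D} in
theorem op_smul_mem_closedSpan (d : D) (n : ℕ) : d • x n ∈ closedSpan D x :=
  Submodule.le_topologicalClosure _ (Submodule.subset_span ⟨n, d, rfl⟩)

theorem closedSpan_le {N : Submodule ℂ E} (hN : IsClosed (N : Set E))
    (h : ∀ (d : D) n, d • x n ∈ N) : closedSpan D x ≤ N := by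
  refine Submodule.topologicalClosure_minimal _ (Submodule.span_le.2 ?_) hN
  rintro _ ⟨n, d, rfl⟩
  exact h d n

variable {D} in
theorem op_smul_mem_of_mem_closedSpan (d : D) {y : E} (hy : y ∈ closedSpan D x) :
    d • y ∈ closedSpan D x :=
  closedSpan_le D (N := (closedSpan D x).comap (opSMulCLM d).toLinearMap)
    ((isClosed_closedSpan D).preimage (opSMulCLM d : E →L[ℂ] E).continuous)
    (fun d' n => by
      change d • d' • x n ∈ closedSpan D x
      rw [← mul_op_smul]
      exact op_smul_mem_closedSpan _ _) hy

theorem self_mem_closedSpan (n : ℕ) : x n ∈ closedSpan D x := by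
  have h := mem_closure_range_op_smul D (x n)
  rw [← SetLike.mem_coe, ← (isClosed_closedSpan D).closure_eq]
  refine closure_mono ?_ h
  rintro _ ⟨d, rfl⟩
  exact op_smul_mem_closedSpan d n

theorem frameOp_mem_closedSpan (hx : Summable fun n => ‖x n‖ ^ 2) (z : E) :
    frameOp D x z ∈ closedSpan D x :=
  (isClosed_closedSpan D).mem_of_tendsto (hasSum_frameOp_apply D hx z)
    (Filter.Eventually.of_forall fun _ => Submodule.sum_mem _ fun n _ => op_smul_mem_closedSpan _ n)

theorem aeval_mem {T : E →L[ℂ] E} {N : Submodule ℂ E} (hT : ∀ z ∈ N, T z ∈ N) (p : ℤ[X]) {z : E}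
    (hz : z ∈ N) : aeval T p z ∈ N := by
  induction p using Polynomial.induction_on' with
  | add p q hp hq => rw [map_add]; exact N.add_mem hp hq
  | monomial n a =>
    rw [aeval_monomial, Algebra.algebraMap_eq_smul_one, smul_mul_assoc, one_mul]
    refine (N.toAddSubgroup.zsmul_mem (x := (T ^ n) z) ?_ a : _)
    induction n with
    | zero => exact hz
    | succ n ih => rw [pow_succ', mul_apply_eq_comp]; exact hT _ ih

/-- The frame attached to a square summable sequence. -/
def frame (x : ℕ → E) (m n : ℕ) : E := aeval (frameOp D x) (iterPoly m) (x n)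

theorem frame_mem_closedSpan (hx : Summable fun n => ‖x n‖ ^ 2) (m n : ℕ) :
    frame D x m n ∈ closedSpan D x :=
  aeval_mem (fun z _ => frameOp_mem_closedSpan D hx z) _ (self_mem_closedSpan D n)

theorem inner_frame (hx : Summable fun n => ‖x n‖ ^ 2) (m n : ℕ) (z : E) :
    inner D (frame D x m n) z = inner D (x n) (aeval (frameOp D x) (iterPoly m) z) :=
  (isSymm_frameOp D hx).aeval _ _ _

theorem hasSum_frame (hx : Summable fun n => ‖x n‖ ^ 2) (m : ℕ) (z : E) :
    HasSum (fun n => inner D (frame D x m n) z • frame D x m n)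
      (aeval (frameOp D x) (iterPoly m * X * iterPoly m) z) := by
  have h := (hasSum_frameOp_apply D hx (aeval (frameOp D x) (iterPoly m) z)).mapL
    (aeval (frameOp D x) (iterPoly m))
  rw [map_mul, map_mul, Polynomial.aeval_X, mul_apply_eq_comp, mul_apply_eq_comp]
  convert h using 2 with n
  rw [inner_frame D hx, ((isSymm_frameOp D hx).aeval _).map_op_smul, frame]

/-- Over a full rectangle the sum is at most `∑ r_m θ r_m = 1 - r_M`, and `r_M ≥ 0`. -/
theorem sum_frame_le (hx : Summable fun n => ‖x n‖ ^ 2) (h1 : ∑' n, ‖x n‖ ^ 2 ≤ 1)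
    (s : Finset (ℕ × ℕ)) (z : E) :
    ∑ p ∈ s, inner D (frame D x p.1 p.2) z * inner D z (frame D x p.1 p.2) ≤ inner D z z := by
  obtain ⟨M, hM⟩ := (s.image Prod.fst).exists_nat_subset_range
  obtain ⟨N, hN⟩ := (s.image Prod.snd).exists_nat_subset_range
  have hsub : s ⊆ Finset.range M ×ˢ Finset.range N := fun p hp =>
    Finset.mem_product.2 ⟨hM (Finset.mem_image_of_mem _ hp), hN (Finset.mem_image_of_mem _ hp)⟩
  refine (Finset.sum_le_sum_of_subset_of_nonneg hsub
    fun p _ _ => inner_mul_inner_nonneg _ _).trans ?_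
  rw [Finset.sum_product]
  have hs := isSymm_frameOp D hx
  have h2 : ∀ m, ∑ n ∈ Finset.range N, inner D (frame D x m n) z * inner D z (frame D x m n)
      ≤ inner D z (aeval (frameOp D x) (iterPoly m * X * iterPoly m) z) := by
    intro m
    have := sum_inner_le_inner_frameOp D hx (Finset.range N) (aeval (frameOp D x) (iterPoly m) z)
    rw [map_mul, map_mul, Polynomial.aeval_X, mul_apply_eq_comp, mul_apply_eq_comp,
      ← hs.aeval (iterPoly m)]
    refine le_trans (le_of_eq (Finset.sum_congr rfl fun n _ => ?_)) this
    rw [inner_frame D hx, frame, hs.aeval]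
  refine (Finset.sum_le_sum fun m _ => h2 m).trans ?_
  rw [← inner_sum_right, ← sum_apply, ← map_sum, sum_iterPoly]
  have h3 := (isPos_iterPoly (isPos_frameOp D hx) (norm_frameOp_le D hx h1) M).1.nonneg z
  rw [map_sub, map_one, sub_apply, inner_sub_right]
  simpa using h3

/-- For a generator put `y = r_M x_n`. Then `⟪x_n, r_M y⟫ = ⟪y, y⟫`, and since the `n`th term of the
frame operator is dominated by `θ`, `M ⟪y, y⟫² ≤ M ⟪r_M y, θ r_M y⟫ ≤ ⟪y, y⟫`. So `M ‖y‖² ≤ 1`. The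
rest of the closed span follows because the `r_M` are contractive module maps. -/
theorem tendsto_aeval_iterPoly (hx : Summable fun n => ‖x n‖ ^ 2) (h1 : ∑' n, ‖x n‖ ^ 2 ≤ 1)
    {z : E} (hz : z ∈ closedSpan D x) :
    Filter.Tendsto (fun M => aeval (frameOp D x) (iterPoly M) z) Filter.atTop (nhds 0) := by
  have hpos := isPos_frameOp D hx
  have hno := norm_frameOp_le D hx h1
  have hs := isSymm_frameOp D hx
  set R : ℕ → E →L[ℂ] E := fun M => aeval (frameOp D x) (iterPoly M) with hR
  have hgen : ∀ n, Filter.Tendsto (fun M => R M (x n)) Filter.atTop (nhds 0) := by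
    intro n
    have hb : ∀ M : ℕ, M * ‖R M (x n)‖ ^ 2 ≤ 1 := by
      intro M
      set y := R M (x n)
      have h2 : inner D (x n) (R M y) * inner D (R M y) (x n)
          ≤ inner D (R M y) (frameOp D x (R M y)) := by
        simpa using sum_inner_le_inner_frameOp D hx {n} (R M y)
      have h3 := (nsmul_le_nsmul_right h2 M).trans (nsmul_inner_iterPoly_le hpos hno M y)
      have h4 := CStarAlgebra.norm_le_norm_of_nonneg_of_le
        (nsmul_nonneg (inner_mul_inner_nonneg _ _) M) h3
      have h5 : inner D (x n) (R M y) = inner D y y := (hs.aeval _ _ _).symm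
      have h6 : inner D (R M y) (x n) = inner D y y := hs.aeval _ _ _
      rw [h5, h6, ← Nat.cast_smul_eq_nsmul ℝ, norm_smul, Real.norm_of_nonneg (Nat.cast_nonneg M)]
        at h4
      have h7 : ‖inner D y y * inner D y y‖ = ‖y‖ ^ 2 * ‖y‖ ^ 2 := by
        conv_lhs => enter [1, 1]; rw [← star_inner]
        rw [CStarRing.norm_star_mul_self, ← norm_sq_eq D]
      rw [h7, ← norm_sq_eq D] at h4
      rcases (norm_nonneg y).eq_or_lt with h | h
      · rw [← h]; norm_num
      · refine le_of_mul_le_mul_right (a := ‖y‖ ^ 2) ?_ (by positivity)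
        linarith
    rw [tendsto_zero_iff_norm_tendsto_zero]
    have h8 : Filter.Tendsto (fun M : ℕ => √(1 / (M : ℝ))) Filter.atTop (nhds 0) := by
      simpa [Function.comp_def] using
        (Real.continuous_sqrt.tendsto 0).comp tendsto_one_div_atTop_nhds_zero_nat
    refine squeeze_zero' (Filter.Eventually.of_forall fun _ => norm_nonneg _) ?_ h8
    filter_upwards [Filter.eventually_gt_atTop 0] with M hM
    refine Real.le_sqrt_of_sq_le ?_
    rw [le_div_iff₀ (by exact_mod_cast hM), mul_comm]
    exact hb M
  let N : Submodule ℂ E :=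
    { carrier := {z | Filter.Tendsto (fun M => R M z) Filter.atTop (nhds 0)}
      add_mem' := fun {a b} ha hb => by
        have := Filter.Tendsto.add (f := fun M => R M a) (g := fun M => R M b) ha hb
        simpa using this
      zero_mem' := by simp
      smul_mem' := fun c a ha => by
        have := Filter.Tendsto.const_smul (f := fun M => R M a) ha c
        simpa using this }
  have hNc : IsClosed (N : Set E) := by
    rw [← closure_subset_iff_isClosed]
    intro z hz
    change Filter.Tendsto (fun M => R M z) Filter.atTop (nhds 0)
    rw [Metric.tendsto_atTop]
    intro ε hε
    obtain ⟨w, hw, hzw⟩ := Metric.mem_closure_iff.1 hz (ε / 2) (by positivity)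
    obtain ⟨K, hK⟩ := Metric.tendsto_atTop.1
      (show Filter.Tendsto (fun M => R M w) Filter.atTop (nhds 0) from hw) (ε / 2) (by positivity)
    refine ⟨K, fun M hM => ?_⟩
    have h9 := hK M hM
    rw [dist_zero_right] at h9 ⊢
    rw [dist_eq_norm] at hzw
    have h10 := norm_aeval_iterPoly_le hpos hno M (z - w)
    rw [map_sub] at h10
    have h11 := norm_le_norm_sub_add (R M z) (R M w)
    change ‖R M z - R M w‖ ≤ _ at h10
    linarith
  refine closedSpan_le D hNc (fun d n => ?_) hz
  change Filter.Tendsto (fun M => R M (d • x n)) Filter.atTop (nhds 0)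
  have h12 := ((opSMulCLM d : E →L[ℂ] E).continuous.tendsto 0).comp (hgen n)
  rw [map_zero] at h12
  convert h12 using 2 with M
  exact (hs.aeval _).map_op_smul d (x n)

end

/-! ### Representing functionals by elements of a countably generated submodule -/

section

open MulOpposite

variable {A : Type*} [NonUnitalCStarAlgebra A] [PartialOrder A] [StarOrderedRing A]
  {E : Type*} [NormedAddCommGroup E] [NormedSpace ℂ E] [SMul Aᵐᵒᵖ E] [CStarModule Aᵐᵒᵖ E]
  [CompleteSpace E]

/-- If every left multiplier of `A ⊗ 𝒦` is a multiplier, then every bounded module map into `A`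
is, after multiplication by an element of `A`, given on a countably generated submodule by the
inner product with an element of the submodule. -/
theorem exists_inner_eq_of_leftMultipliers_eq
    (hA : leftMultipliers (CStarTensor A CompactsEllTwo) =
      multipliers (CStarTensor A CompactsEllTwo))
    {x : ℕ → E} (hx : Summable fun n => ‖x n‖ ^ 2) (h1 : ∑' n, ‖x n‖ ^ 2 ≤ 1)
    (f : E →L[ℂ] A) (hf : ∀ (z : E) (a : A), f (op a • z) = f z * a) (a' : A) :
    ∃ e ∈ closedSpan Aᵐᵒᵖ x, ∀ z ∈ closedSpan Aᵐᵒᵖ x, inner Aᵐᵒᵖ e z = op (a' * f z) := by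
  -- The frame is reindexed by `ℕ` because the rows of `A ⊗ 𝒦` are.
  set y : ℕ → E := fun k => frame Aᵐᵒᵖ x k.unpair.1 k.unpair.2 with hy
  have hbessel : ∀ (s : Finset ℕ) (z : E),
      ∑ k ∈ s, inner Aᵐᵒᵖ (y k) z * inner Aᵐᵒᵖ z (y k) ≤ inner Aᵐᵒᵖ z z := by
    intro s z
    have h := sum_frame_le Aᵐᵒᵖ hx h1 (s.map Nat.pairEquiv.symm.toEmbedding) z
    rw [Finset.sum_map] at h
    exact h
  have hsyn := fun s => sq_norm_sum_op_smul_le y s (hbessel s)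
  let g : ℕ → A →ₗ[ℂ] A := fun k => f.toLinearMap ∘ₗ
    (orbitCLM (y k) : Aᵐᵒᵖ →L[ℂ] E).toLinearMap ∘ₗ (opLinearEquiv ℂ : A ≃ₗ[ℂ] Aᵐᵒᵖ).toLinearMap
  have hgdef : ∀ k a, g k a = f (op a • y k) := fun k a => rfl
  have hg : ∀ k a b, g k (a * b) = g k a * b := by
    intro k a b
    rw [hgdef, op_mul, mul_op_smul, hf, hgdef]
  have hgC : ∀ (s : Finset ℕ) (c : ℕ → A),
      ‖∑ k ∈ s, g k (c k)‖ ^ 2 ≤ ‖f‖ ^ 2 * ‖∑ k ∈ s, star (c k) * c k‖ := by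
    intro s c
    simp only [hgdef]
    rw [← map_sum]
    have h2 := hsyn s fun k => op (c k)
    have h3 : ∑ k ∈ s, op (c k) * star (op (c k)) = op (∑ k ∈ s, star (c k) * c k) := by
      rw [Finset.op_sum]; rfl
    rw [h3, norm_op] at h2
    calc _ ≤ (‖f‖ * ‖∑ k ∈ s, op (c k) • y k‖) ^ 2 := by gcongr; exact f.le_opNorm _
      _ = ‖f‖ ^ 2 * ‖∑ k ∈ s, op (c k) • y k‖ ^ 2 := mul_pow _ _ _
      _ ≤ _ := by gcongr
  obtain ⟨r, hr, htail⟩ :=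
    CStarTensor.exists_row_of_leftMultipliers_eq hA hg (norm_nonneg f) hgC a'
  -- The synthesis bound turns the small tails of `∑ r_k r_k*` into the Cauchy criterion for `∑ y_k
  -- r_k*`.
  have hsum : Summable fun k => op (star (r k)) • y k := by
    rw [summable_iff_vanishing_norm]
    intro ε hε
    obtain ⟨s, hs⟩ := htail (ε ^ 2) (by positivity)
    refine ⟨s, fun t ht => ?_⟩
    have h2 := hsyn t fun k => op (star (r k))
    have h3 : ∑ k ∈ t, op (star (r k)) * star (op (star (r k)))
        = op (∑ k ∈ t, r k * star (r k)) := by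
      rw [Finset.op_sum]
      exact Finset.sum_congr rfl fun k _ => by rw [← op_star, star_star, op_mul]
    rw [h3, norm_op] at h2
    exact lt_of_pow_lt_pow_left₀ 2 hε.le (h2.trans_lt (hs t ht))
  refine ⟨∑' k, op (star (r k)) • y k, ?_, fun z hz => ?_⟩
  · refine (isClosed_closedSpan Aᵐᵒᵖ).mem_of_tendsto hsum.hasSum
      (Filter.Eventually.of_forall fun s => Submodule.sum_mem _ fun k _ => ?_)
    exact op_smul_mem_of_mem_closedSpan _ (frame_mem_closedSpan Aᵐᵒᵖ hx _ _)
  · set e := ∑' k, op (star (r k)) • y k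
    let F : E →L[ℂ] Aᵐᵒᵖ := (opContinuousLinearEquiv ℂ : A ≃L[ℂ] Aᵐᵒᵖ).toContinuousLinearMap ∘L
      (ContinuousLinearMap.mul ℂ A a') ∘L f
    have hF : ∀ w, F w = op (a' * f w) := fun w => rfl
    have hk : ∀ k, inner Aᵐᵒᵖ (op (star (r k)) • y k) z = F (inner Aᵐᵒᵖ (y k) z • y k) := by
      intro k
      have h2 := hr k (unop (inner Aᵐᵒᵖ (y k) z))
      rw [hgdef, op_unop] at h2
      rw [hF, ← h2, inner_op_smul_left, ← op_star, star_star, op_mul, op_unop]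
    have h2 : HasSum (fun k => F (inner Aᵐᵒᵖ (y k) z • y k)) (inner Aᵐᵒᵖ e z) := by
      have h3 := (hsum.hasSum.mapL (innerSL z : E →L[ℂ] Aᵐᵒᵖ)).star
      simp only [innerSL_apply, star_inner] at h3
      simpa only [hk] using h3
    -- Convergence is unconditional, so the sum may be regrouped over pairs and taken over `n`
    -- first; the partial sums over `m` then telescope.
    have h3 : HasSum (fun p : ℕ × ℕ =>
        F (inner Aᵐᵒᵖ (frame Aᵐᵒᵖ x p.1 p.2) z • frame Aᵐᵒᵖ x p.1 p.2)) (inner Aᵐᵒᵖ e z) := by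
      rw [← Nat.pairEquiv.symm.hasSum_iff]
      exact h2
    have h4 := h3.prod_fiberwise fun m => (hasSum_frame Aᵐᵒᵖ hx m z).mapL F
    have h5 := h4.tendsto_sum_nat
    have h6 : ∀ M, ∑ m ∈ Finset.range M,
        F (aeval (frameOp Aᵐᵒᵖ x) (iterPoly m * X * iterPoly m) z)
        = F (z - aeval (frameOp Aᵐᵒᵖ x) (iterPoly M) z) := by
      intro M
      rw [← map_sum, ← sum_apply, ← map_sum, sum_iterPoly, map_sub, map_one]
      rfl
    simp only [h6] at h5
    have h7 : Filter.Tendsto (fun M => F (z - aeval (frameOp Aᵐᵒᵖ x) (iterPoly M) z))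
        Filter.atTop (nhds (F z)) := by
      have h8 := (tendsto_const_nhds (x := z)).sub (tendsto_aeval_iterPoly Aᵐᵒᵖ hx h1 hz)
      rw [sub_zero] at h8
      exact (F.continuous.tendsto z).comp h8
    exact tendsto_nhds_unique h5 h7

end

end CStarModule

/-! ### Adjoints on countably generated submodules, and lifting -/

namespace CStarModule

open Polynomial MulOpposite

section

variable {A : Type*} [NonUnitalCStarAlgebra A] [PartialOrder A] [StarOrderedRing A]
  {E F : Type*} [NormedAddCommGroup E] [NormedSpace ℂ E] [SMul Aᵐᵒᵖ E] [CStarModule Aᵐᵒᵖ E]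
  [CompleteSpace E] [NormedAddCommGroup F] [NormedSpace ℂ F] [SMul Aᵐᵒᵖ F] [CStarModule Aᵐᵒᵖ F]

theorem eq_of_inner_eq_of_mem {N : Submodule ℂ E} {e e' : E} (he : e ∈ N) (he' : e' ∈ N)
    (h : ∀ z ∈ N, inner Aᵐᵒᵖ e z = inner Aᵐᵒᵖ e' z) : e = e' := by
  rw [← sub_eq_zero, ← inner_self (A := Aᵐᵒᵖ), inner_sub_left, h _ (N.sub_mem he he'), sub_self]

theorem norm_le_of_inner_eq {N : Submodule ℂ E} {φ : E →L[ℂ] F} {e : E} {y : F} (he : e ∈ N)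
    (h : ∀ z ∈ N, inner Aᵐᵒᵖ e z = inner Aᵐᵒᵖ y (φ z)) : ‖e‖ ≤ ‖φ‖ * ‖y‖ := by
  have h1 : ‖e‖ * ‖e‖ ≤ (‖φ‖ * ‖y‖) * ‖e‖ := by
    rw [← sq, norm_sq_eq Aᵐᵒᵖ, h e he]
    refine (norm_inner_le F).trans ?_
    calc _ ≤ ‖y‖ * (‖φ‖ * ‖e‖) := by gcongr; exact φ.le_opNorm e
      _ = _ := by ring
  rcases (norm_nonneg e).eq_or_lt with h0 | h0
  · rw [← h0]; positivity
  · exact le_of_mul_le_mul_right h1 h0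

/-- A bounded module map is adjointable on countably generated submodules of its domain. -/
theorem exists_adjoint_of_leftMultipliers_eq
    (hA : leftMultipliers (CStarTensor A CompactsEllTwo) =
      multipliers (CStarTensor A CompactsEllTwo))
    {x : ℕ → E} (hx : Summable fun n => ‖x n‖ ^ 2) (h1 : ∑' n, ‖x n‖ ^ 2 ≤ 1)
    (φ : E →L[ℂ] F) (hφ : ∀ (z : E) (d : Aᵐᵒᵖ), φ (d • z) = d • φ z) :
    ∃ S : F →L[ℂ] E, (∀ y, S y ∈ closedSpan Aᵐᵒᵖ x) ∧
      ∀ y, ∀ z ∈ closedSpan Aᵐᵒᵖ x, inner Aᵐᵒᵖ (S y) z = inner Aᵐᵒᵖ y (φ z) := by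
  set N := closedSpan Aᵐᵒᵖ x
  have hN : IsClosed (N : Set E) := isClosed_closedSpan Aᵐᵒᵖ
  -- Acting by `d` on `y` supplies the factor `a' = d*` that the representation of functionals
  -- requires. The vectors `d • y` approximate `y`, and `norm_le_of_inner_eq` carries the
  -- representing elements to the limit.
  have hex1 : ∀ (y : F) (d : Aᵐᵒᵖ), ∃ e ∈ N, ∀ z ∈ N, inner Aᵐᵒᵖ e z = inner Aᵐᵒᵖ (d • y) (φ z) := by
    intro y d
    let f : E →L[ℂ] A := (opContinuousLinearEquiv ℂ : A ≃L[ℂ] Aᵐᵒᵖ).symm.toContinuousLinearMap ∘L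
      (innerSL y : F →L[ℂ] Aᵐᵒᵖ) ∘L φ
    have hf : ∀ z, f z = unop (inner Aᵐᵒᵖ y (φ z)) := fun z => rfl
    obtain ⟨e, he, h⟩ := exists_inner_eq_of_leftMultipliers_eq hA hx h1 f
      (fun z a => by rw [hf, hφ, inner_op_smul_right, unop_mul, unop_op, hf]) (unop (star d))
    refine ⟨e, he, fun z hz => ?_⟩
    rw [h z hz, hf, inner_op_smul_left, op_mul, op_unop, op_unop]
  have hex : ∀ y : F, ∃ e ∈ N, ∀ z ∈ N, inner Aᵐᵒᵖ e z = inner Aᵐᵒᵖ y (φ z) := by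
    intro y
    obtain ⟨u, hu, huy⟩ := mem_closure_iff_seq_limit.1 (mem_closure_range_op_smul Aᵐᵒᵖ y)
    choose d hd using hu
    choose e he hez using fun k => hex1 y (d k)
    simp only [hd] at hez
    have hdiff : ∀ k l, ‖e k - e l‖ ≤ ‖φ‖ * ‖u k - u l‖ := fun k l =>
      norm_le_of_inner_eq (A := A) (N.sub_mem (he k) (he l)) fun z hz => by
        rw [inner_sub_left, inner_sub_left, hez k z hz, hez l z hz]
    have hc : CauchySeq e := by
      rw [Metric.cauchySeq_iff]
      intro ε hε
      obtain ⟨K, hK⟩ := Metric.cauchySeq_iff.1 huy.cauchySeq (ε / (‖φ‖ + 1)) (by positivity)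
      refine ⟨K, fun k hk l hl => ?_⟩
      have h2 := hK k hk l hl
      rw [dist_eq_norm] at h2 ⊢
      rw [lt_div_iff₀ (by positivity)] at h2
      nlinarith [hdiff k l, norm_nonneg (u k - u l), norm_nonneg φ]
    obtain ⟨e', he'⟩ := cauchySeq_tendsto_of_complete hc
    refine ⟨e', hN.mem_of_tendsto he' (Filter.Eventually.of_forall he), fun z hz => ?_⟩
    have h3 : Filter.Tendsto (fun k => inner Aᵐᵒᵖ (e k) z) Filter.atTop
        (nhds (inner Aᵐᵒᵖ e' z)) :=
      ((continuous_inner (A := Aᵐᵒᵖ) (E := E)).comp (Continuous.prodMk_left z)).tendsto e'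
        |>.comp he'
    have h4 : Filter.Tendsto (fun k => inner Aᵐᵒᵖ (u k) (φ z)) Filter.atTop
        (nhds (inner Aᵐᵒᵖ y (φ z))) :=
      ((continuous_inner (A := Aᵐᵒᵖ) (E := F)).comp (Continuous.prodMk_left (φ z))).tendsto y
        |>.comp huy
    simp only [hez _ z hz] at h3
    exact tendsto_nhds_unique h3 h4
  choose S hS hSz using hex
  refine ⟨LinearMap.mkContinuous ⟨⟨S, fun y y' => ?_⟩, fun c y => ?_⟩ ‖φ‖ fun y =>
    norm_le_of_inner_eq (A := A) (hS y) (hSz y), hS, hSz⟩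
  · refine eq_of_inner_eq_of_mem (A := A) (hS _) (N.add_mem (hS _) (hS _)) fun z hz => ?_
    rw [inner_add_left, hSz _ z hz, hSz _ z hz, hSz _ z hz, inner_add_left]
  · refine eq_of_inner_eq_of_mem (A := A) (hS _) (N.smul_mem _ (hS _)) fun z hz => ?_
    simp only [RingHom.id_apply]
    rw [inner_smul_left_complex, hSz _ z hz, hSz _ z hz, inner_smul_left_complex]

/-- A positive contraction that is bounded below on an invariant closed submodule is invertible
there. -/
theorem exists_rightInverse_on [CompleteSpace F] {θ : F →L[ℂ] F} (hθ : IsPos Aᵐᵒᵖ θ)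
    (h1 : ‖θ‖ ≤ 1) {N : Submodule ℂ F} (hN : IsClosed (N : Set F))
    (hNd : ∀ (d : Aᵐᵒᵖ), ∀ y ∈ N, d • y ∈ N) (hθN : ∀ y ∈ N, θ y ∈ N) {κ : ℝ} (hκ : 0 < κ)
    (hlow : ∀ y ∈ N, κ * ‖y‖ ≤ ‖θ y‖) :
    ∃ V : N →L[ℂ] F, (∀ y : N, θ (V y) = y) ∧
      ∀ (d : Aᵐᵒᵖ) (y : F) (hy : y ∈ N), V ⟨d • y, hNd d y hy⟩ = d • V ⟨y, hy⟩ := by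
  -- From `M κ² ‖r_M y‖² ≤ M ‖θ r_M y‖² ≤ ‖y‖²`, the choice `M > 4 / κ²` gives `‖r_M‖ ≤ 1 / 2` on
  -- `N`.
  obtain ⟨M, hM⟩ := exists_nat_gt (4 / κ ^ 2)
  set R : F →L[ℂ] F := aeval θ (iterPoly M) with hR
  have hRN : ∀ y ∈ N, R y ∈ N := fun y hy => aeval_mem hθN _ hy
  have hRle : ∀ y ∈ N, ‖R y‖ ≤ (1 / 2) * ‖y‖ := by
    intro y hy
    have h2 := mul_sq_norm_iterPoly_le hθ h1 M y
    have h3 := hlow (R y) (hRN y hy)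
    rw [div_lt_iff₀ (by positivity)] at hM
    have h4 : (κ * ‖R y‖) ^ 2 ≤ ‖θ (R y)‖ ^ 2 := by gcongr
    refine le_of_sq_le_sq ?_ (by positivity)
    have h5 : (M : ℝ) * (κ * ‖R y‖) ^ 2 ≤ ‖y‖ ^ 2 := le_trans (by gcongr) h2
    nlinarith [sq_nonneg ‖R y‖]
  let R₀ : N →L[ℂ] N := (R ∘L N.subtypeL).codRestrict N fun y => hRN y y.2
  have hR₀ : ‖R₀‖ < 1 := lt_of_le_of_lt
    (ContinuousLinearMap.opNorm_le_bound _ (by norm_num) fun y => hRle y y.2)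
    (by norm_num : (1 / 2 : ℝ) < 1)
  have : CompleteSpace N := hN.completeSpace_coe
  obtain ⟨U, hU⟩ := isUnit_one_sub_of_norm_lt_one (R := N →L[ℂ] N) (x := R₀) hR₀
  -- Since `1 - r_M = θ q(θ)` and `1 - r_M` is invertible on `N`, the right inverse of `θ` is `q(θ)
  -- (1 - r_M)⁻¹`.
  obtain ⟨q, hq⟩ := X_dvd_one_sub_iterPoly M
  have hqθ : ∀ y, θ (aeval θ q y) = y - R y := by
    intro y
    rw [← mul_apply_eq_comp]
    have h2 : aeval θ (1 - iterPoly M) = θ * aeval θ q := by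
      rw [hq, map_mul, Polynomial.aeval_X]
    rw [← h2, map_sub, map_one]
    rfl
  let u : N →L[ℂ] N := ↑U⁻¹
  have hu : ∀ y : N, (u y : F) - R (u y) = y := by
    intro y
    have h2 : (1 - R₀) * u = 1 := by rw [← hU]; exact U.mul_inv
    have h3 := congrArg (fun T : N →L[ℂ] N => (T y : F)) h2
    exact h3
  have hinj : ∀ y : N, u (y - R₀ y) = y := by
    intro y
    have h2 : u * (1 - R₀) = 1 := by rw [← hU]; exact U.inv_mul
    exact congrArg (fun T : N →L[ℂ] N => T y) h2
  refine ⟨aeval θ q ∘L N.subtypeL ∘L u, fun y => ?_, fun d y hy => ?_⟩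
  · change θ (aeval θ q (u y)) = y
    rw [hqθ, hu]
  · change aeval θ q (u ⟨d • y, _⟩ : F) = d • aeval θ q (u ⟨y, hy⟩ : F)
    rw [← (hθ.symm.aeval q).map_op_smul]
    congr 1
    set w : N := ⟨d • (u ⟨y, hy⟩ : F), hNd d _ (u ⟨y, hy⟩).2⟩ with hw
    have h2 : (⟨d • y, hNd d y hy⟩ : N) = w - R₀ w := by
      apply Subtype.ext
      change d • y = d • (u ⟨y, hy⟩ : F) - R (d • (u ⟨y, hy⟩ : F))
      rw [(hθ.symm.aeval _).map_op_smul]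
      have h3 : ∀ a b : F, d • (a - b) = d • a - d • b := fun a b =>
        map_sub (opSMulCLM d : F →L[ℂ] F) a b
      rw [← h3, hu ⟨y, hy⟩]
    rw [h2, hinj]

theorem separableSpace_of_isCountablyGenerated [TopologicalSpace.SeparableSpace A]
    (hE : IsCountablyGenerated A E) : TopologicalSpace.SeparableSpace E := by
  obtain ⟨S, hS, hd⟩ := hE
  rw [← TopologicalSpace.isSeparable_univ_iff, ← hd.closure_eq]
  refine TopologicalSpace.IsSeparable.closure (TopologicalSpace.IsSeparable.span ?_)
  have h : {y : E | ∃ x ∈ S, ∃ a : A, y = op a • x}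
      = ⋃ x ∈ S, Set.range fun a : A => op a • x := by
    ext y
    simp only [Set.mem_ofPred_eq, Set.mem_iUnion, Set.mem_range, exists_prop]
    exact ⟨fun ⟨x, hx, a, h⟩ => ⟨x, hx, a, h.symm⟩, fun ⟨x, hx, a, h⟩ => ⟨x, hx, a, h.symm⟩⟩
  rw [h]
  have := hS.to_subtype
  rw [Set.biUnion_eq_iUnion]
  refine TopologicalSpace.IsSeparable.iUnion fun x => ?_
  exact TopologicalSpace.isSeparable_range
    ((orbitCLM (x : E) : Aᵐᵒᵖ →L[ℂ] E).continuous.comp continuous_op)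

end

section

variable {A : Type*} [NonUnitalCStarAlgebra A] [PartialOrder A] [StarOrderedRing A]
  {H E F : Type*} [NormedAddCommGroup E] [NormedSpace ℂ E] [SMul Aᵐᵒᵖ E] [CStarModule Aᵐᵒᵖ E]
  [CompleteSpace E] [NormedAddCommGroup F] [NormedSpace ℂ F] [SMul Aᵐᵒᵖ F] [CStarModule Aᵐᵒᵖ F]
  [CompleteSpace F] [NormedAddCommGroup H] [NormedSpace ℂ H] [SMul Aᵐᵒᵖ H] [CStarModule Aᵐᵒᵖ H]
  [TopologicalSpace.SeparableSpace H]

/-- The lift is `S (φ S)⁻¹ ψ`, where `S` is the adjoint of `φ` relative to the submodule generated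
by preimages of a dense sequence in the closure of the range of `ψ`. -/
theorem exists_lift_of_leftMultipliers_eq
    (hA : leftMultipliers (CStarTensor A CompactsEllTwo) =
      multipliers (CStarTensor A CompactsEllTwo))
    (φ : E →L[ℂ] F) (hφ : ∀ (z : E) (d : Aᵐᵒᵖ), φ (d • z) = d • φ z)
    (hsurj : Function.Surjective φ)
    (ψ : H →L[ℂ] F) (hψ : ∀ (z : H) (d : Aᵐᵒᵖ), ψ (d • z) = d • ψ z) :
    ∃ χ : H →L[ℂ] E, (∀ (z : H) (d : Aᵐᵒᵖ), χ (d • z) = d • χ z) ∧ φ ∘L χ = ψ := by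
  obtain ⟨C, hC, hpre⟩ := φ.exists_preimage_norm_le hsurj
  set N : Submodule ℂ F := (LinearMap.range ψ.toLinearMap).topologicalClosure with hNdef
  have hN : IsClosed (N : Set F) := Submodule.isClosed_topologicalClosure _
  have hψN : ∀ h, ψ h ∈ N := fun h => Submodule.le_topologicalClosure _ ⟨h, rfl⟩
  have hNd : ∀ (d : Aᵐᵒᵖ), ∀ y ∈ N, d • y ∈ N := by
    intro d y hy
    have h : N ≤ N.comap (opSMulCLM d : F →L[ℂ] F).toLinearMap := by
      refine Submodule.topologicalClosure_minimal _ ?_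
        (hN.preimage (opSMulCLM d : F →L[ℂ] F).continuous)
      rintro _ ⟨h, rfl⟩
      change d • ψ h ∈ N
      rw [← hψ]
      exact hψN _
    exact h hy
  have hNsep : TopologicalSpace.SeparableSpace N := by
    refine TopologicalSpace.IsSeparable.separableSpace (s := (N : Set F)) ?_
    rw [hNdef, Submodule.topologicalClosure_coe]
    exact (TopologicalSpace.isSeparable_range ψ.continuous).closure
  set y : ℕ → N := TopologicalSpace.denseSeq N
  have hyd : DenseRange y := TopologicalSpace.denseRange_denseSeq N
  choose x hx hxC using fun n => hpre (y n : F)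
  -- Rescaling makes the sequence square summable with sum at most `1` and leaves the generated
  -- submodule unchanged.
  let c : ℕ → ℝ := fun n => (1 / 2) ^ (n + 1) / (‖x n‖ + 1)
  have hc : ∀ n, 0 < c n := fun n => by positivity
  let x' : ℕ → E := fun n => (c n : ℂ) • x n
  have hx'n : ∀ n, ‖x' n‖ ^ 2 ≤ (1 / 2) ^ (n + 1) := by
    intro n
    have h2 : ‖x' n‖ ≤ (1 / 2) ^ (n + 1) := by
      simp only [x', norm_smul, Complex.norm_real, Real.norm_of_nonneg (hc n).le]
      rw [div_mul_eq_mul_div, div_le_iff₀ (by positivity)]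
      gcongr
      linarith
    calc ‖x' n‖ ^ 2 ≤ ((1 / 2) ^ (n + 1)) ^ 2 := by gcongr
      _ = (1 / 2 : ℝ) ^ (n + 1) * (1 / 2) ^ (n + 1) := sq _
      _ ≤ (1 / 2) ^ (n + 1) * 1 := by gcongr; exact pow_le_one₀ (by norm_num) (by norm_num)
      _ = _ := mul_one _
  have hgeo : HasSum (fun n : ℕ => (1 / 2 : ℝ) ^ (n + 1)) 1 := by
    have := hasSum_geometric_two.mul_right (1 / 2 : ℝ)
    norm_num at this
    simpa [pow_succ] using this
  have hsum : Summable fun n => ‖x' n‖ ^ 2 :=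
    Summable.of_nonneg_of_le (fun _ => by positivity) hx'n hgeo.summable
  have hle : ∑' n, ‖x' n‖ ^ 2 ≤ 1 := by
    rw [← hgeo.tsum_eq]
    exact hsum.tsum_le_tsum hx'n hgeo.summable
  obtain ⟨S, hSmem, hS⟩ := exists_adjoint_of_leftMultipliers_eq hA hsum hle φ hφ
  set K := closedSpan Aᵐᵒᵖ x'
  have hxK : ∀ n, x n ∈ K := by
    intro n
    have h2 : x n = (c n : ℂ)⁻¹ • x' n := by
      rw [smul_smul, inv_mul_cancel₀ (by exact_mod_cast (hc n).ne'), one_smul]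
    rw [h2]
    exact K.smul_mem _ (self_mem_closedSpan Aᵐᵒᵖ n)
  have hφK : ∀ z ∈ K, φ z ∈ N := by
    intro z hz
    refine closedSpan_le Aᵐᵒᵖ (N := N.comap φ.toLinearMap) (hN.preimage φ.continuous)
      (fun d n => ?_) hz
    change φ (d • (c n : ℂ) • x n) ∈ N
    rw [hφ, map_smul, hx]
    exact hNd _ _ (N.smul_mem _ (y n).2)
  have hSd : ∀ (d : Aᵐᵒᵖ) (w : F), S (d • w) = d • S w := by
    intro d w
    refine eq_of_inner_eq_of_mem (A := A) (hSmem _) (op_smul_mem_of_mem_closedSpan d (hSmem w))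
      fun z hz => ?_
    rw [hS _ z hz, inner_op_smul_left, inner_op_smul_left, hS _ z hz]
  -- On the dense sequence, `⟪y_n, y_n⟫ = ⟪y_n, φ x_n⟫ = ⟪S y_n, x_n⟫` and `‖x_n‖ ≤ C ‖y_n‖`. The
  -- constant does not depend on `n`, so the bound passes to `N`.
  have hSlow : ∀ w : N, ‖(w : F)‖ ≤ C * ‖S w‖ := by
    intro w
    refine hyd.induction_on w ?_ fun n => ?_
    · exact isClosed_le (by fun_prop) (by fun_prop)
    · have h2 : ‖(y n : F)‖ * ‖(y n : F)‖ ≤ (C * ‖S (y n)‖) * ‖(y n : F)‖ := by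
        rw [← sq, norm_sq_eq Aᵐᵒᵖ]
        nth_rewrite 2 [← hx n]
        rw [← hS _ _ (hxK n)]
        refine (norm_inner_le E).trans ?_
        calc _ ≤ ‖S (y n)‖ * (C * ‖(y n : F)‖) := by gcongr; exact hxC n
          _ = _ := by ring
      rcases (norm_nonneg (y n : F)).eq_or_lt with h0 | h0
      · rw [← h0]; positivity
      · exact le_of_mul_le_mul_right h2 h0
  set G : F →L[ℂ] F := φ ∘L S with hG
  -- The relation defining `S` applies because `S w` lies in `K`. It makes `φ S` positive on all of
  -- `F`, although `S` is an adjoint of `φ` only relative to `K`.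
  have hGinner : ∀ v w, inner Aᵐᵒᵖ v (G w) = inner Aᵐᵒᵖ (S v) (S w) := fun v w =>
    (hS v _ (hSmem w)).symm
  have hGsymm : IsSymm Aᵐᵒᵖ G := fun v w => by
    rw [← star_inner, hGinner, star_inner, hGinner]
  have hGlow : ∀ w ∈ N, ‖w‖ ≤ C ^ 2 * ‖G w‖ := by
    intro w hw
    have h2 := hSlow ⟨w, hw⟩
    have h3 : ‖S w‖ ^ 2 ≤ ‖w‖ * ‖G w‖ := by
      rw [norm_sq_eq Aᵐᵒᵖ, ← hGinner]; exact norm_inner_le F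
    have h4 : ‖w‖ * ‖w‖ ≤ (C ^ 2 * ‖G w‖) * ‖w‖ := by
      calc ‖w‖ * ‖w‖ ≤ (C * ‖S w‖) * (C * ‖S w‖) := by gcongr
        _ = C ^ 2 * ‖S w‖ ^ 2 := by ring
        _ ≤ C ^ 2 * (‖w‖ * ‖G w‖) := by gcongr
        _ = _ := by ring
    rcases (norm_nonneg w).eq_or_lt with h0 | h0
    · rw [← h0]; positivity
    · exact le_of_mul_le_mul_right h4 h0
  -- Normalises `φ S` to a contraction `θ`; the factor `t` returns in the lift, where `t φ S V = θ
  -- V` is the identity on `N`.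
  set t : ℝ := (‖G‖ + 1)⁻¹ with ht
  have htpos : 0 < t := by positivity
  set θ : F →L[ℂ] F := (t : ℂ) • G with hθdef
  have hθ : IsPos Aᵐᵒᵖ θ := by
    refine ⟨fun v w => ?_, fun v => ?_⟩
    · simp only [hθdef, smul_apply, inner_smul_left_complex, inner_smul_right_complex, hGsymm v w,
        Complex.star_def, Complex.conj_ofReal]
    · simp only [hθdef, smul_apply, inner_smul_right_complex, hGinner]
      rw [Complex.coe_smul]
      exact smul_nonneg htpos.le inner_self_nonneg
  have hθ1 : ‖θ‖ ≤ 1 := by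
    rw [hθdef, norm_smul, Complex.norm_real, Real.norm_of_nonneg htpos.le, ht, inv_mul_le_iff₀
      (by positivity)]
    linarith
  obtain ⟨V, hV, hVd⟩ := exists_rightInverse_on hθ hθ1 hN hNd
    (fun w _ => by
      change (t : ℂ) • φ (S w) ∈ N
      exact N.smul_mem _ (hφK _ (hSmem w)))
    (κ := t / C ^ 2) (by positivity) (fun w hw => by
      rw [hθdef, smul_apply, norm_smul, Complex.norm_real, Real.norm_of_nonneg htpos.le,
        div_mul_eq_mul_div, div_le_iff₀ (by positivity)]
      calc t * ‖w‖ ≤ t * (C ^ 2 * ‖G w‖) := by gcongr; exact hGlow w hw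
        _ = _ := by ring)
  let ψ₀ : H →L[ℂ] N := ψ.codRestrict N hψN
  refine ⟨(t : ℂ) • (S ∘L V ∘L ψ₀), fun z d => ?_, ?_⟩
  · change (t : ℂ) • S (V (ψ₀ (d • z))) = d • (t : ℂ) • S (V (ψ₀ z))
    have h2 : ψ₀ (d • z) = ⟨d • ψ z, hNd d _ (hψN z)⟩ := Subtype.ext (hψ z d)
    rw [h2, hVd d _ (hψN z), hSd, op_smul_smul]
    rfl
  · ext z
    change φ ((t : ℂ) • S (V (ψ₀ z))) = ψ z
    rw [map_smul]
    exact hV (ψ₀ z)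

end

end CStarModule

end

theorem theorem3p10
    (A : Type u) [NonUnitalCStarAlgebra A] [PartialOrder A] [StarOrderedRing A]
    [TopologicalSpace.SeparableSpace A]
    (hA : leftMultipliers (CStarTensor A CompactsEllTwo) =
      multipliers (CStarTensor A CompactsEllTwo))
    (H : Type v) [NormedAddCommGroup H] [NormedSpace ℂ H] [SMul Aᵐᵒᵖ H] [CStarModule Aᵐᵒᵖ H]
    [CompleteSpace H] (hH : IsCountablyGenerated A H) :
    IsProjectiveHilbertModule.{u, v, w₁, w₂} A H := by
  intro H₁ _ _ _ _ _ H₂ _ _ _ _ _ φ hφ hsurj ψ hψ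
  have := CStarModule.separableSpace_of_isCountablyGenerated hH
  obtain ⟨χ, hχ, h⟩ := CStarModule.exists_lift_of_leftMultipliers_eq hA φ
    (fun z d => hφ z d.unop) hsurj ψ (fun z d => hψ z d.unop)
  exact ⟨χ, fun z a => hχ z (MulOpposite.op a), h⟩
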